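/- Let $X_2$ be the set of all lattices $L\subset\mathbb{R}^2$ of covolume one. Identify it with $\mathrm{SL}(2,\mathbb{Z})\backslash\mathrm{SL}(2,\mathbb{R})$ through $A\mapsto\mathbb{Z}^2A$, and let $\mu_0$ be the $\mathrm{SL}(2,\mathbb{R})$-invariant Borel probability measure on $X_2$. Let $\mathfrak{P}=\{x\in\mathbb{R}^2 : |x_1|+|x_2|\le 1\}$ and, for $L\in X_2$, let $\rho(\mathfrak{P},L)=\inf\{r>0 : r\mathfrak{P}+L=\mathbb{R}^2\}$ be the covering radius of $\mathfrak{P}$ with respect to $L$. For $R\in\mathbb{R}$ put $$\tilde P_2(R)=\mu_0\bigl(\{L\in X_2 : \rho(\mathfrak{P},L)>R\}\bigr).$$ Then $\tilde P_2$ is differentiable at every $R\in\mathbb{R}$, and the density $\tilde p_2(R)=-\frac{d}{dR}\tilde P_2(R)$ of $\rho(\mathfrak{P},L)$, for $L$ random according to $\mu_0$, is given by $$\tilde p_2(R)=\begin{cases}0 & (R\le \tfrac1{\sqrt2}),\\[4pt] \dfrac{24}{\pi^2}\left(\dfrac{2R^2-1}{R}\log\Bigl(\dfrac{2R^2}{2R^2-1}\Bigr)+\dfrac{1-R^2}{R}\log\Bigl(\dfrac{R^2}{|1-R^2|}\Bigr)\right)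 & (R>\tfrac1{\sqrt2}),\end{cases}$$ where at $R=1$ the second summand in the bracket is understood as $0$ (its limit). -/

import Mathlib

open MeasureTheory
open scoped Pointwise

noncomputable section

/-- The set `X_k` of all lattices `L ⊂ ℝ^k` of covolume one. -/
structure UnimodularLattice (k : ℕ) where
  /-- the underlying additive subgroup of `ℝ^k` -/
  toSubmodule : Submodule ℤ (Fin k → ℝ)
  discrete : DiscreteTopology toSubmodule
  isZLattice : IsZLattice ℝ toSubmodule
  covolume_eq_one : ZLattice.covolume toSubmodule = 1

theorem linearIndependent_row {k : ℕ} (A : Matrix.SpecialLinearGroup (Fin k) ℝ) :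
    LinearIndependent ℝ A.1.row :=
  Matrix.linearIndependent_rows_of_det_ne_zero (A := A.1) (by rw [A.2]; exact one_ne_zero)

/-- The rows of a matrix of determinant one form a basis of `ℝ^k`. -/
def rowBasis {k : ℕ} (A : Matrix.SpecialLinearGroup (Fin k) ℝ) :
    Module.Basis (Fin k) ℝ (Fin k → ℝ) :=
  Module.Basis.mk (linearIndependent_row A)
    ((linearIndependent_row A).span_eq_top_of_card_eq_finrank' (by simp)).ge

theorem coe_rowBasis {k : ℕ} (A : Matrix.SpecialLinearGroup (Fin k) ℝ) :
    ⇑(rowBasis A) = A.1.row :=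
  Module.Basis.coe_mk _ _

theorem covolume_span_rowBasis {k : ℕ} (A : Matrix.SpecialLinearGroup (Fin k) ℝ) :
    ZLattice.covolume (Submodule.span ℤ (Set.range (rowBasis A))) = 1 := by
  rw [ZLattice.covolume_eq_det _ ((rowBasis A).restrictScalars ℤ)]
  have h : Matrix.of (Subtype.val ∘ ⇑((rowBasis A).restrictScalars ℤ)) = A.1 := by
    ext i j
    simp [coe_rowBasis]
  rw [h, A.2, abs_one]

instance discreteTopology_span_row {k : ℕ} (A : Matrix.SpecialLinearGroup (Fin k) ℝ) :
    DiscreteTopology (Submodule.span ℤ (Set.range A.1.row)) := by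
  rw [← coe_rowBasis]
  infer_instance

/-- The lattice `ℤ^k A` spanned by the rows of `A ∈ SL(k, ℝ)`. -/
def rowLattice {k : ℕ} (A : Matrix.SpecialLinearGroup (Fin k) ℝ) : UnimodularLattice k where
  toSubmodule := Submodule.span ℤ (Set.range A.1.row)
  discrete := discreteTopology_span_row A
  isZLattice := ⟨by
    rw [Submodule.span_span_of_tower]
    exact (linearIndependent_row A).span_eq_top_of_card_eq_finrank' (by simp)⟩
  covolume_eq_one := by
    rw [← coe_rowBasis]
    exact covolume_span_rowBasis A

/-- The topology on `X_k` as the homogeneous space `SL(k, ℤ) \ SL(k, ℝ)`: the quotient topology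
along `A ↦ ℤ^k A`. -/
instance UnimodularLattice.instTopologicalSpace (k : ℕ) :
    TopologicalSpace (UnimodularLattice k) :=
  TopologicalSpace.coinduced rowLattice inferInstance

instance UnimodularLattice.instMeasurableSpace (k : ℕ) : MeasurableSpace (UnimodularLattice k) :=
  borel _

instance UnimodularLattice.instBorelSpace (k : ℕ) : BorelSpace (UnimodularLattice k) := ⟨rfl⟩

instance specialLinearGroupMeasurableSpace (k : ℕ) :
    MeasurableSpace (Matrix.SpecialLinearGroup (Fin k) ℝ) :=
  borel _

instance specialLinearGroupBorelSpace (k : ℕ) :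
    BorelSpace (Matrix.SpecialLinearGroup (Fin k) ℝ) := ⟨rfl⟩

instance specialLinearGroupLocallyCompactSpace (k : ℕ) :
    LocallyCompactSpace (Matrix.SpecialLinearGroup (Fin k) ℝ) :=
  haveI : LocallyCompactSpace (Matrix (Fin k) (Fin k) ℝ) :=
    inferInstanceAs (LocallyCompactSpace (Fin k → Fin k → ℝ))
  Matrix.SpecialLinearGroup.isClosedEmbedding_val.locallyCompactSpace

/-- The set of all `A ∈ SL(2, ℝ)` that move `i` into the standard fundamental domain of the
modular group in the upper half-plane. Up to null sets it meets every orbit `SL(2, ℤ) A`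
in exactly the two points `± A₀`. -/
def modularDomain : Set (Matrix.SpecialLinearGroup (Fin 2) ℝ) :=
  {A | A • UpperHalfPlane.I ∈ ModularGroup.fd}

/-- The `SL(2, ℝ)`-invariant probability measure on `X_2 = SL(2, ℤ) \ SL(2, ℝ)`: Haar measure of
`SL(2, ℝ)` on a fundamental domain for `SL(2, ℤ)`, pushed forward by `A ↦ ℤ² A` and divided by the
total mass. -/
def invariantMeasure : Measure (UnimodularLattice 2) :=
  ((Measure.haar : Measure (Matrix.SpecialLinearGroup (Fin 2) ℝ)) modularDomain)⁻¹ •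
    (((Measure.haar : Measure (Matrix.SpecialLinearGroup (Fin 2) ℝ)).restrict
      modularDomain).map rowLattice)

/-- The covering radius `ρ(K, L) = inf {r > 0 : rK + L = ℝ^k}`. -/
def coveringRadius {k : ℕ} (K : Set (Fin k → ℝ)) (L : UnimodularLattice k) : ℝ :=
  sInf {r : ℝ | 0 < r ∧ r • K + (L.toSubmodule : Set (Fin k → ℝ)) = Set.univ}

/-- The cross-polytope `{x ∈ ℝ^k : |x₁| + ⋯ + |x_k| ≤ 1}`. -/
def crossPolytope (k : ℕ) : Set (Fin k → ℝ) :=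
  {x | ∑ i, |x i| ≤ 1}

/-- The complementary distribution function of `ρ(𝔓, L)` for `L` random in `X_2`. -/
def tildeP₂ (R : ℝ) : ℝ :=
  invariantMeasure.real {L : UnimodularLattice 2 | R < coveringRadius (crossPolytope 2) L}

/-- The limit density: minus the derivative of the complementary distribution function. -/
def tildep₂ (R : ℝ) : ℝ :=
  - deriv tildeP₂ R

end

open scoped ENNReal

noncomputable section

/-! The diamond is symmetric, so the translates of `R𝔓` by `L` miss a point `z` exactly when `z +
R𝔓` contains no point of `L`. The unimodular map `diamondToRectangle` turns `R𝔓` into a rectangle of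
width `1` and height `2R²`. Since the measure is invariant, the question becomes how likely it is
that some translate of this rectangle contains no lattice point.

A generic lattice has exactly one basis `(u₁, v₁)`, `(-u₂, v₂)` with `0 < u₁, u₂ < 1`, `u₁ + u₂ ≥ 1`
and `v₁, v₂ > 0`: the lowest lattice vectors above the axis in the strips `0 < x < 1` and `-1 < x <
0` (`exists_strip_basis`, `eq_one_of_mem_stripDomain`). Inside a vertical strip of width one, the
successive lattice points differ by one of these vectors or by their sum. Hence, off the null set
`u₁ + u₂ = 1`, an empty rectangle of height `T` exists if and only if `T < v₁ + v₂`
(`exists_lattice_point_in_rectangle`, `exists_empty_rectangle`). The strip bases form a fundamental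
domain for `SL(2, ℤ)`, so the probability sought is the normalised Haar measure of its part with `v₁
+ v₂ > 2R²`.

Haar measure is realised as the volume of the cone over a set. In the coordinates `u₁`, `u₂`, `σ =
v₁ + v₂` and the determinant, scaling integrates out the determinant, and what remains is the
density `1 / |u₂ - u₁|` on the region where `1 / σ` lies between `u₁` and `u₂`
(`coneMeasure_stripTail`). Integrating over everything gives `π² / 12`, by way of `ζ(2)`
(`coneMeasure_stripDomain`). Integrating at fixed `σ = 1 / x`, with `x < 1`, gives `-(1 - x) log (1
- x) - (2x - 1) log |2x - 1| / 2` (`lintegral_lintegral_gapDensity`). Differentiating the tail at `T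
= 2R²` yields the formula. -/

/-! ### Haar measure on `SL(2, ℝ)` as cone volume. -/

/-- The determinant of a real `2 × 2` array. -/
def arrayDet (M : Fin 2 → Fin 2 → ℝ) : ℝ := M 0 0 * M 1 1 - M 0 1 * M 1 0

theorem continuous_arrayDet : Continuous arrayDet := by
  unfold arrayDet; fun_prop

/-- The element of `SL(2, ℝ)` with given entries. -/
def mkSL (M : Fin 2 → Fin 2 → ℝ) (h : arrayDet M = 1) : Matrix.SpecialLinearGroup (Fin 2) ℝ :=
  ⟨Matrix.of M, by rw [Matrix.det_fin_two]; exact h⟩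

@[simp] theorem mkSL_apply (M : Fin 2 → Fin 2 → ℝ) (h : arrayDet M = 1) (i j : Fin 2) :
    mkSL M h i j = M i j := rfl

theorem specialLinearGroup_det_eq (A : Matrix.SpecialLinearGroup (Fin 2) ℝ) :
    A 0 0 * A 1 1 - A 0 1 * A 1 0 = 1 := by
  rw [← Matrix.det_fin_two, A.det_coe]

theorem specialLinearGroup_mul_apply (A B : Matrix.SpecialLinearGroup (Fin 2) ℝ) (i j : Fin 2) :
    (A * B) i j = A i 0 * B 0 j + A i 1 * B 1 j := by
  simp [Matrix.mul_apply]

/-- Divide a real `2 × 2` matrix of positive determinant by the square root of its determinant. -/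
def normalizeDet (M : Fin 2 → Fin 2 → ℝ) : Matrix.SpecialLinearGroup (Fin 2) ℝ :=
  if h : 0 < arrayDet M then
    mkSL (fun i j => (√(arrayDet M))⁻¹ * M i j) (by
      have h2 : (√(arrayDet M))⁻¹ ^ 2 * arrayDet M = 1 := by
        rw [inv_pow, Real.sq_sqrt h.le, inv_mul_cancel₀ h.ne']
      rw [← h2]
      simp only [arrayDet]
      ring)
  else 1

theorem normalizeDet_apply {M : Fin 2 → Fin 2 → ℝ} (h : 0 < arrayDet M) (i j : Fin 2) :
    normalizeDet M i j = (√(arrayDet M))⁻¹ * M i j := by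
  rw [normalizeDet, dif_pos h, mkSL_apply]

/-- The real matrices with determinant strictly between `0` and `1`. -/
def detUnit : Set (Fin 2 → Fin 2 → ℝ) := {M | 0 < arrayDet M ∧ arrayDet M < 1}

theorem measurableSet_detUnit : MeasurableSet detUnit :=
  ((isOpen_lt continuous_const continuous_arrayDet).inter
    (isOpen_lt continuous_arrayDet continuous_const)).measurableSet

/-- The entries of a matrix in `SL(2, ℝ)`. -/
def entries (A : Matrix.SpecialLinearGroup (Fin 2) ℝ) : Fin 2 → Fin 2 → ℝ := fun i j => A i j

theorem isInducing_entries : Topology.IsInducing entries := ⟨rfl⟩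

theorem continuous_entries : Continuous entries := isInducing_entries.continuous

theorem specialLinearGroup_measurable_iff {α : Type*} [MeasurableSpace α]
    {f : α → Matrix.SpecialLinearGroup (Fin 2) ℝ} :
    Measurable f ↔ ∀ i j, Measurable fun x => f x i j := by
  have hpi : (MeasurableSpace.pi : MeasurableSpace (Fin 2 → Fin 2 → ℝ)) = borel _ :=
    BorelSpace.measurable_eq
  have h : specialLinearGroupMeasurableSpace 2 =
      MeasurableSpace.comap entries MeasurableSpace.pi := by
    rw [hpi, ← borel_comap, ← isInducing_entries.eq_induced]
    rfl
  rw [h, measurable_comap_iff, measurable_pi_iff]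
  exact forall_congr' fun i => measurable_pi_iff

theorem measurable_normalizeDet : Measurable normalizeDet := by
  rw [specialLinearGroup_measurable_iff]
  intro i j
  have h : (fun M => normalizeDet M i j) = fun M =>
      if 0 < arrayDet M then (√(arrayDet M))⁻¹ * M i j
      else (1 : Matrix.SpecialLinearGroup (Fin 2) ℝ) i j := by
    funext M
    split_ifs with h
    · rw [normalizeDet_apply h]
    · rw [normalizeDet, dif_neg h]
  rw [h]
  refine Measurable.ite (measurableSet_lt measurable_const continuous_arrayDet.measurable) ?_
    measurable_const
  exact (continuous_arrayDet.measurable.sqrt.inv).mul (by fun_prop)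

/-- The measure on `SL(2, ℝ)` which assigns to a set the volume of the cone over it. -/
def coneMeasure : Measure (Matrix.SpecialLinearGroup (Fin 2) ℝ) :=
  ((volume : Measure (Fin 2 → Fin 2 → ℝ)).restrict detUnit).map normalizeDet

theorem coneMeasure_apply {E : Set (Matrix.SpecialLinearGroup (Fin 2) ℝ)} (hE : MeasurableSet E) :
    coneMeasure E = volume (normalizeDet ⁻¹' E ∩ detUnit) := by
  rw [coneMeasure, Measure.map_apply measurable_normalizeDet hE,
    Measure.restrict_apply (measurable_normalizeDet hE)]

/-- Right multiplication of arrays by a matrix. -/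
def arrayMulRight (B : Matrix.SpecialLinearGroup (Fin 2) ℝ) (M : Fin 2 → Fin 2 → ℝ) :
    Fin 2 → Fin 2 → ℝ := fun i j => M i 0 * B 0 j + M i 1 * B 1 j

/-- Left multiplication of arrays by a matrix. -/
def arrayMulLeft (B : Matrix.SpecialLinearGroup (Fin 2) ℝ) (M : Fin 2 → Fin 2 → ℝ) :
    Fin 2 → Fin 2 → ℝ := fun i j => B i 0 * M 0 j + B i 1 * M 1 j

theorem volume_preserving_arrayMulRight (B : Matrix.SpecialLinearGroup (Fin 2) ℝ) :
    MeasurePreserving (arrayMulRight B) := by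
  have h : MeasurePreserving (fun v : Fin 2 → ℝ => Matrix.toLin' B.transpose.1 v) := by
    refine ⟨(LinearMap.continuous_on_pi _).measurable, ?_⟩
    rw [Real.map_matrix_volume_pi_eq_smul_volume_pi (by simp), B.transpose.det_coe]
    simp
  have h2 := volume_preserving_pi (fun _ : Fin 2 => h)
  convert h2 using 1
  funext M i j
  simp [arrayMulRight, Matrix.mulVec, dotProduct, mul_comm]

/-- Transposition is an involution, so its determinant is `±1`. It transfers the invariance of
volume from right to left multiplication. -/
theorem volume_preserving_transpose :
    MeasurePreserving (fun M : Fin 2 → Fin 2 → ℝ => fun i j => M j i) := by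
  let f : (Fin 2 → Fin 2 → ℝ) →ₗ[ℝ] (Fin 2 → Fin 2 → ℝ) :=
    { toFun := fun M i j => M j i, map_add' := fun _ _ => rfl, map_smul' := fun _ _ => rfl }
  have hff : f ∘ₗ f = LinearMap.id := rfl
  have hdet : LinearMap.det f * LinearMap.det f = 1 := by
    rw [← LinearMap.det_comp, hff, LinearMap.det_id]
  have habs : |(LinearMap.det f)⁻¹| = 1 := by
    rcases mul_self_eq_one_iff.1 hdet with h | h <;> simp [h]
  have h0 : LinearMap.det f ≠ 0 := fun h => by simp [h] at hdet
  refine ⟨f.continuous_of_finiteDimensional.measurable, ?_⟩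
  have := Measure.map_linearMap_addHaar_eq_smul_addHaar (volume : Measure (Fin 2 → Fin 2 → ℝ)) h0
  rw [habs, ENNReal.ofReal_one, one_smul] at this
  exact this

theorem volume_preserving_arrayMulLeft (B : Matrix.SpecialLinearGroup (Fin 2) ℝ) :
    MeasurePreserving (arrayMulLeft B) := by
  have h := (volume_preserving_transpose.comp
    (volume_preserving_arrayMulRight B.transpose)).comp volume_preserving_transpose
  convert h using 1
  funext M i j
  simp [arrayMulLeft, arrayMulRight, mul_comm, Function.comp]

theorem arrayDet_arrayMulLeft (B : Matrix.SpecialLinearGroup (Fin 2) ℝ) (M : Fin 2 → Fin 2 → ℝ) :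
    arrayDet (arrayMulLeft B M) = arrayDet M := by
  simp only [arrayDet, arrayMulLeft]
  linear_combination (M 0 0 * M 1 1 - M 0 1 * M 1 0) * specialLinearGroup_det_eq B

theorem arrayDet_arrayMulRight (B : Matrix.SpecialLinearGroup (Fin 2) ℝ) (M : Fin 2 → Fin 2 → ℝ) :
    arrayDet (arrayMulRight B M) = arrayDet M := by
  simp only [arrayDet, arrayMulRight]
  linear_combination (M 0 0 * M 1 1 - M 0 1 * M 1 0) * specialLinearGroup_det_eq B

theorem normalizeDet_arrayMulLeft (B : Matrix.SpecialLinearGroup (Fin 2) ℝ)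
    {M : Fin 2 → Fin 2 → ℝ} (hM : 0 < arrayDet M) :
    normalizeDet (arrayMulLeft B M) = B * normalizeDet M := by
  ext i j
  rw [normalizeDet_apply (by rwa [arrayDet_arrayMulLeft]), arrayDet_arrayMulLeft,
    specialLinearGroup_mul_apply, normalizeDet_apply hM, normalizeDet_apply hM, arrayMulLeft]
  ring

theorem normalizeDet_arrayMulRight (B : Matrix.SpecialLinearGroup (Fin 2) ℝ)
    {M : Fin 2 → Fin 2 → ℝ} (hM : 0 < arrayDet M) :
    normalizeDet (arrayMulRight B M) = normalizeDet M * B := by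
  ext i j
  rw [normalizeDet_apply (by rwa [arrayDet_arrayMulRight]), arrayDet_arrayMulRight,
    specialLinearGroup_mul_apply, normalizeDet_apply hM, normalizeDet_apply hM, arrayMulRight]
  ring

/-- Multiplication by `B` preserves volume and determinant and commutes with `normalizeDet`, so it
carries cones to cones of equal volume. -/
instance : coneMeasure.IsMulLeftInvariant where
  map_mul_left_eq_self B := by
    ext E hE
    rw [Measure.map_apply (measurable_const_mul B) hE,
      coneMeasure_apply (measurable_const_mul B hE), coneMeasure_apply hE,
      ← (volume_preserving_arrayMulLeft B).measure_preimage
        ((measurable_normalizeDet hE).inter measurableSet_detUnit).nullMeasurableSet]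
    congr 1
    ext M
    simp only [Set.mem_inter_iff, Set.mem_preimage, detUnit, Set.mem_ofPred_eq,
      arrayDet_arrayMulLeft]
    refine and_congr_left fun hM => ?_
    rw [normalizeDet_arrayMulLeft B hM.1]

instance : coneMeasure.IsMulRightInvariant where
  map_mul_right_eq_self B := by
    ext E hE
    rw [Measure.map_apply (measurable_mul_const B) hE,
      coneMeasure_apply (measurable_mul_const B hE), coneMeasure_apply hE,
      ← (volume_preserving_arrayMulRight B).measure_preimage
        ((measurable_normalizeDet hE).inter measurableSet_detUnit).nullMeasurableSet]
    congr 1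
    ext M
    simp only [Set.mem_inter_iff, Set.mem_preimage, detUnit, Set.mem_ofPred_eq,
      arrayDet_arrayMulRight]
    refine and_congr_left fun hM => ?_
    rw [normalizeDet_arrayMulRight B hM.1]

instance : SecondCountableTopology (Matrix.SpecialLinearGroup (Fin 2) ℝ) :=
  isInducing_entries.secondCountableTopology

/-- A point of the cone over `K` is an element of `K` scaled by `√det < 1`, so the cone over a
bounded set is bounded. -/
instance : IsFiniteMeasureOnCompacts coneMeasure where
  lt_top_of_isCompact K hK := by
    rw [coneMeasure_apply hK.measurableSet]
    obtain ⟨C, hC⟩ := (hK.image continuous_entries).isBounded.exists_norm_le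
    refine lt_of_le_of_lt (measure_mono ?_)
      (Metric.isBounded_closedBall (x := (0 : Fin 2 → Fin 2 → ℝ)) (r := C)).measure_lt_top
    rintro M ⟨hM, h0, h1⟩
    have h2 := hC _ ⟨_, hM, rfl⟩
    have h4 : M = √(arrayDet M) • entries (normalizeDet M) := by
      funext i j
      simp only [Pi.smul_apply, entries, normalizeDet_apply h0, smul_eq_mul]
      rw [mul_inv_cancel_left₀ (Real.sqrt_ne_zero'.2 h0)]
    rw [mem_closedBall_zero_iff, h4, norm_smul, Real.norm_of_nonneg (Real.sqrt_nonneg _)]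
    calc _ ≤ 1 * C := mul_le_mul (Real.sqrt_le_one.2 h1.le) h2 (norm_nonneg _) zero_le_one
      _ = C := one_mul C

theorem exists_coneMeasure_eq_smul_haar : ∃ c : NNReal, coneMeasure =
    c • (Measure.haar : Measure (Matrix.SpecialLinearGroup (Fin 2) ℝ)) :=
  ⟨_, Measure.isMulLeftInvariant_eq_smul _ _⟩

/-! ### The strip basis of a planar lattice. -/

theorem finite_lattice_box {a b c d : ℝ} (hdet : a * d - b * c ≠ 0) (C : ℝ) :
    {z : ℤ × ℤ | |z.1 * a + z.2 * c| ≤ C ∧ |z.1 * b + z.2 * d| ≤ C}.Finite := by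
  set K : ℝ := (C * |d| + C * |c| + C * |a| + C * |b|) / |a * d - b * c| with hK
  have hpos : 0 < |a * d - b * c| := abs_pos.2 hdet
  refine (((Set.finite_Icc (-⌈K⌉) ⌈K⌉).prod (Set.finite_Icc (-⌈K⌉) ⌈K⌉))).subset ?_
  rintro ⟨m, n⟩ ⟨hx, hy⟩
  simp only at hx hy
  have hC : 0 ≤ C := (abs_nonneg _).trans hx
  have h1 : ∀ k : ℤ, |(k : ℝ)| ≤ K → k ∈ Set.Icc (-⌈K⌉) ⌈K⌉ := by
    intro k hk
    have h2 := abs_le.1 (hk.trans (Int.le_ceil K))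
    exact ⟨by exact_mod_cast h2.1, by exact_mod_cast h2.2⟩
  have ha := mul_nonneg hC (abs_nonneg a)
  have hb := mul_nonneg hC (abs_nonneg b)
  have hc := mul_nonneg hC (abs_nonneg c)
  have hd := mul_nonneg hC (abs_nonneg d)
  constructor
  · apply h1
    rw [hK, le_div_iff₀ hpos, ← abs_mul]
    calc |(m : ℝ) * (a * d - b * c)| = |(m * a + n * c) * d - (m * b + n * d) * c| := by
          congr 1; ring
      _ ≤ |m * a + n * c| * |d| + |m * b + n * d| * |c| := by
          rw [← abs_mul, ← abs_mul]; exact abs_sub _ _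
      _ ≤ C * |d| + C * |c| := by gcongr
      _ ≤ _ := by linarith
  · apply h1
    rw [hK, le_div_iff₀ hpos, ← abs_mul]
    calc |(n : ℝ) * (a * d - b * c)| = |(m * b + n * d) * a - (m * a + n * c) * b| := by
          congr 1; ring
      _ ≤ |m * b + n * d| * |a| + |m * a + n * c| * |b| := by
          rw [← abs_mul, ← abs_mul]; exact abs_sub _ _
      _ ≤ C * |a| + C * |b| := by gcongr
      _ ≤ _ := by linarith

/-- Dirichlet's approximation theorem for `a / c`, followed by a choice of sign. -/
theorem exists_small_pos_combination {a c : ℝ}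
    (hx : ∀ m n : ℤ, (m ≠ 0 ∨ n ≠ 0) → m * a + n * c ≠ 0) {ε : ℝ} (hε : 0 < ε) :
    ∃ m n : ℤ, 0 < m * a + n * c ∧ m * a + n * c < ε := by
  have hc : c ≠ 0 := by simpa using hx 0 1 (by simp)
  obtain ⟨N, hN⟩ := exists_nat_gt (|c| / ε)
  obtain ⟨j, k, hk, -, hjk⟩ := Real.exists_int_int_abs_mul_sub_le (a / c) (Nat.succ_pos N)
  have hne := hx k (-j) (Or.inl hk.ne')
  have hlt : |k * a + (-j : ℤ) * c| < ε := by
    have h1 : (k * a + (-j : ℤ) * c : ℝ) = (k * (a / c) - j) * c := by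
      push_cast; field_simp; ring
    rw [h1, abs_mul]
    calc _ ≤ 1 / ((N.succ : ℕ) + 1 : ℝ) * |c| := by gcongr
      _ < ε := by
        rw [div_mul_eq_mul_div, one_mul, div_lt_iff₀ (by positivity)]
        rw [div_lt_iff₀ hε] at hN
        push_cast
        nlinarith
  rcases lt_or_gt_of_ne hne with h | h
  · refine ⟨-k, j, ?_, ?_⟩
    · push_cast at h ⊢; linarith
    · rw [abs_of_neg h] at hlt
      push_cast at hlt ⊢; linarith
  · exact ⟨k, -j, h, by rwa [abs_of_pos h] at hlt⟩

theorem exists_lowest_in_strip {a b c d : ℝ} (hdet : a * d - b * c ≠ 0)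
    (hx : ∀ m n : ℤ, (m ≠ 0 ∨ n ≠ 0) → m * a + n * c ≠ 0)
    (hy : ∀ m n : ℤ, (m ≠ 0 ∨ n ≠ 0) → m * b + n * d ≠ 0) :
    ∃ m n : ℤ, 0 < m * a + n * c ∧ m * a + n * c < 1 ∧ 0 < m * b + n * d ∧
      ∀ m' n' : ℤ, 0 < m' * a + n' * c → m' * a + n' * c < 1 → 0 < m' * b + n' * d →
        m * b + n * d ≤ m' * b + n' * d := by
  have key : ∃ m n : ℤ, 0 < m * a + n * c ∧ m * a + n * c < 1 ∧ 0 < m * b + n * d := by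
    -- Suppose every lattice point with `0 < x < 1` had `y ≤ 0`. Among those with `|y|` bounded as
    -- for the first point, take the one nearest the vertical axis. A point still nearer must lie
    -- strictly lower, and subtracting it leaves a strip point with `y > 0`.
    obtain ⟨m, n, h0, h1⟩ := exists_small_pos_combination hx one_pos
    by_contra! hcon
    have hneg : m * b + n * d < 0 := by
      refine lt_of_le_of_ne (hcon m n h0 h1) (hy m n ?_)
      by_contra! h
      simp [h.1, h.2] at h0
    set C := max 1 |m * b + n * d| with hC
    have hfin : {z : ℤ × ℤ | 0 < z.1 * a + z.2 * c ∧ z.1 * a + z.2 * c < 1 ∧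
        |z.1 * b + z.2 * d| ≤ |m * b + n * d|}.Finite := by
      refine (finite_lattice_box hdet C).subset ?_
      rintro ⟨k, l⟩ ⟨h2, h3, h4⟩
      exact ⟨by rw [abs_of_pos h2]; exact h3.le.trans (le_max_left _ _),
        h4.trans (le_max_right _ _)⟩
    obtain ⟨⟨k, l⟩, ⟨h2, h3, h4⟩, hmin⟩ := hfin.exists_minimalFor
      (fun z : ℤ × ℤ => (z.1 * a + z.2 * c : ℝ)) _ ⟨(m, n), h0, h1, le_rfl⟩
    obtain ⟨p, q, h5, h6⟩ := exists_small_pos_combination hx h2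
    simp only at h2 h3 h4 hmin
    have h7 : |m * b + n * d| < |p * b + q * d| := by
      by_contra! h
      have := hmin (j := (p, q)) ⟨h5, h6.trans h3, h⟩ h6.le
      simp only at this
      linarith
    have h8 := hcon p q h5 (h6.trans h3)
    rw [abs_of_neg hneg] at h4 h7
    rw [abs_of_nonpos h8] at h7
    have h9 := hcon (k - p) (l - q) (by push_cast; linarith) (by push_cast; linarith)
    push_cast at h9
    have h10 := (abs_le.1 h4).1
    linarith
  obtain ⟨m, n, h0, h1, h2⟩ := key
  set C := max 1 (m * b + n * d) with hC
  have hfin : {z : ℤ × ℤ | 0 < z.1 * a + z.2 * c ∧ z.1 * a + z.2 * c < 1 ∧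
      0 < z.1 * b + z.2 * d ∧ z.1 * b + z.2 * d ≤ m * b + n * d}.Finite := by
    refine (finite_lattice_box hdet C).subset ?_
    rintro ⟨k, l⟩ ⟨h3, h4, h5, h6⟩
    exact ⟨by rw [abs_of_pos h3]; exact h4.le.trans (le_max_left _ _),
      by rw [abs_of_pos h5]; exact h6.trans (le_max_right _ _)⟩
  obtain ⟨⟨k, l⟩, ⟨h3, h4, h5, h6⟩, hmin⟩ := Set.exists_min_image _
    (fun z : ℤ × ℤ => (z.1 * b + z.2 * d : ℝ)) hfin ⟨(m, n), h0, h1, h2, le_rfl⟩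
  refine ⟨k, l, h3, h4, h5, fun m' n' g0 g1 g2 => ?_⟩
  by_cases h : m' * b + n' * d ≤ m * b + n * d
  · exact hmin (m', n') ⟨g0, g1, g2, h⟩
  · exact h6.trans (not_le.1 h).le

theorem exists_strip_basis {a b c d : ℝ} (hdet : a * d - b * c = 1)
    (hx : ∀ m n : ℤ, (m ≠ 0 ∨ n ≠ 0) → m * a + n * c ≠ 0)
    (hy : ∀ m n : ℤ, (m ≠ 0 ∨ n ≠ 0) → m * b + n * d ≠ 0) :
    ∃ p q r s : ℤ, p * s - q * r = 1 ∧ 0 < p * a + q * c ∧ p * a + q * c < 1 ∧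
      r * a + s * c < 0 ∧ -1 < r * a + s * c ∧ 1 ≤ (p * a + q * c) - (r * a + s * c) ∧
      0 < p * b + q * d ∧ 0 < r * b + s * d := by
  obtain ⟨p, q, u0, u1, v0, hmin1⟩ := exists_lowest_in_strip (by rw [hdet]; simp) hx hy
  obtain ⟨r, s, w0, w1, z0, hmin2⟩ := exists_lowest_in_strip (a := -a) (c := -c) (b := b) (d := d)
    (by have : -a * d - b * -c = -1 := by linarith
        rw [this]; simp) (fun m n h h2 => hx m n h (by linarith)) hy
  -- Otherwise the difference of the two vectors, taken with the sign that makes its height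
  -- positive, would lie in one of the two strips below the lowest point there.
  have hsum : 1 ≤ (p * a + q * c) - (r * a + s * c) := by
    by_contra! h
    have hne : (p - r : ℤ) * b + (q - s : ℤ) * d ≠ 0 := by
      refine hy _ _ ?_
      by_contra! h2
      rw [sub_eq_zero, sub_eq_zero] at h2
      rw [h2.1, h2.2] at u0
      linarith
    rcases lt_or_gt_of_ne hne with h2 | h2
    · have := hmin2 (r - p) (s - q) (by push_cast; linarith) (by push_cast; linarith)
        (by push_cast at h2 ⊢; linarith)
      push_cast at this
      linarith
    · have := hmin1 (p - r) (q - s) (by push_cast; linarith) (by push_cast; linarith) h2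
      push_cast at this
      linarith
  have hlow1 : ∀ m n : ℤ, 0 < m * a + n * c → m * a + n * c < 1 → 0 ≤ m * b + n * d →
      p * b + q * d ≤ m * b + n * d := fun m n h0 h1 h2 =>
    hmin1 m n h0 h1 (lt_of_le_of_ne h2 (Ne.symm (hy m n (by
      by_contra! h; simp [h.1, h.2] at h0))))
  have hlow2 : ∀ m n : ℤ, m * a + n * c < 0 → -1 < m * a + n * c → 0 ≤ m * b + n * d →
      r * b + s * d ≤ m * b + n * d := fun m n h0 h1 h2 =>
    hmin2 m n (by linarith) (by linarith) (lt_of_le_of_ne h2 (Ne.symm (hy m n (by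
      by_contra! h; simp [h.1, h.2] at h0))))
  -- the half-open parallelogram contains no further lattice point
  have hempty : ∀ (m n : ℤ) (α β : ℝ), 0 ≤ α → α < 1 → 0 ≤ β → β < 1 →
      m * a + n * c = α * (p * a + q * c) + β * (r * a + s * c) →
      m * b + n * d = α * (p * b + q * d) + β * (r * b + s * d) → m = 0 ∧ n = 0 := by
    intro m n α β hα hα1 hβ hβ1 h1 h2
    by_contra hne
    have hne' : m ≠ 0 ∨ n ≠ 0 := by
      by_contra! h; exact hne h
    have e1 : 0 ≤ α * (p * a + q * c) := mul_nonneg hα u0.le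
    have e2' : α * (p * a + q * c) < p * a + q * c := by nlinarith
    have e3 : β * (r * a + s * c) ≤ 0 := by nlinarith
    have e4 : r * a + s * c < β * (r * a + s * c) := by nlinarith
    have e5 : 0 ≤ α * (p * b + q * d) := mul_nonneg hα v0.le
    have e6 : α * (p * b + q * d) < p * b + q * d := by nlinarith
    have e7 : 0 ≤ β * (r * b + s * d) := mul_nonneg hβ z0.le
    have e8 : β * (r * b + s * d) < r * b + s * d := by nlinarith
    -- Subtracting the basis vector on the same side of the axis gives a point on the other side
    -- that is lower than the basis vector there.
    rcases lt_or_gt_of_ne (hx m n hne') with h | h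
    · have f1 := hlow2 m n h (by linarith) (by linarith)
      have f2 := hlow1 (m - r) (n - s) (by push_cast; linarith) (by push_cast; linarith)
        (by push_cast; linarith)
      push_cast at f2
      linarith
    · have f1 := hlow1 m n h (by linarith) (by linarith)
      have f2 := hlow2 (m - p) (n - q) (by push_cast; linarith) (by push_cast; linarith)
        (by push_cast; linarith)
      push_cast at f2
      linarith
  set D : ℝ := (p * a + q * c) * (r * b + s * d) - (p * b + q * d) * (r * a + s * c) with hD
  have hDpos : 0 < D := by
    have := mul_pos u0 z0
    have := mul_pos v0 w0
    linarith
  have hDint : D = ((p * s - q * r : ℤ) : ℝ) := by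
    push_cast
    rw [hD]
    linear_combination ((p : ℝ) * s - q * r) * hdet
  have hinteger : ∀ m n : ℤ, ∃ k l : ℤ, m = k * p + l * r ∧ n = k * q + l * s := by
    intro m n
    set X : ℝ := m * a + n * c with hX
    set Y : ℝ := m * b + n * d with hY
    set α : ℝ := (X * (r * b + s * d) - Y * (r * a + s * c)) / D with hα
    set β : ℝ := (Y * (p * a + q * c) - X * (p * b + q * d)) / D with hβ
    have g1 : X = α * (p * a + q * c) + β * (r * a + s * c) := by
      rw [hα, hβ]; field_simp; rw [hD]; ring
    have g2 : Y = α * (p * b + q * d) + β * (r * b + s * d) := by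
      rw [hα, hβ]; field_simp; rw [hD]; ring
    -- Reducing the real coordinates of a lattice point modulo one puts it in the empty
    -- parallelogram, so these coordinates are integers.
    have := hempty (m - (⌊α⌋ * p + ⌊β⌋ * r)) (n - (⌊α⌋ * q + ⌊β⌋ * s)) (Int.fract α) (Int.fract β)
      (Int.fract_nonneg _) (Int.fract_lt_one _) (Int.fract_nonneg _) (Int.fract_lt_one _)
      (by simp only [Int.fract]; push_cast; linear_combination g1)
      (by simp only [Int.fract]; push_cast; linear_combination g2)
    exact ⟨⌊α⌋, ⌊β⌋, by linarith [this.1], by linarith [this.2]⟩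
  obtain ⟨k1, l1, h1, h2⟩ := hinteger 1 0
  obtain ⟨k2, l2, h3, h4⟩ := hinteger 0 1
  have hunit : (k1 * l2 - l1 * k2) * (p * s - q * r) = 1 := by
    have : (k1 * l2 - l1 * k2) * (p * s - q * r) =
      (k1 * p + l1 * r) * (k2 * q + l2 * s) - (k1 * q + l1 * s) * (k2 * p + l2 * r) := by ring
    rw [this, ← h1, ← h2, ← h3, ← h4]; norm_num
  have hpos : 0 < p * s - q * r := by
    rw [hDint] at hDpos
    exact_mod_cast hDpos
  have hone : p * s - q * r = 1 :=
    Int.eq_one_or_neg_one_of_mul_eq_one' hunit |>.elim (fun h => h.2) (fun h => by omega)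
  exact ⟨p, q, r, s, hone, u0, u1, by linarith, by linarith, hsum, v0, z0⟩

/-- A basis of a planar lattice adapted to the strip of width one is unique. -/
theorem strip_basis_unique {a b c d : ℝ} (ha0 : 0 < a) (hc0 : c < 0)
    (hac : 1 ≤ a - c) (hb : 0 < b) (hd : 0 < d) {p q r s : ℤ}
    (h1 : 0 < p * a + q * c) (h2 : p * a + q * c < 1) (h3 : r * a + s * c < 0)
    (h4 : -1 < r * a + s * c) (h5 : 0 < p * b + q * d) (h6 : 0 < r * b + s * d) :
    1 ≤ p ∧ 0 ≤ q ∧ 0 ≤ r ∧ 1 ≤ s := by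
  -- With `m ≥ 1` and `n ≤ -1` the abscissa is at least `a - c ≥ 1`. With `m ≤ 0`, either the
  -- abscissa or the height fails to be positive.
  have key : ∀ m n : ℤ, 0 < m * a + n * c → m * a + n * c < 1 → 0 < m * b + n * d →
      1 ≤ m ∧ 0 ≤ n := by
    intro m n g1 g2 g3
    by_cases hm : 1 ≤ m
    · refine ⟨hm, ?_⟩
      by_contra! hn
      have hm' : (1 : ℝ) ≤ m := by exact_mod_cast hm
      have hn' : (n : ℝ) ≤ -1 := by exact_mod_cast Int.le_sub_one_of_lt hn
      nlinarith
    · exfalso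
      have hm' : (m : ℝ) ≤ 0 := by exact_mod_cast (by omega : m ≤ 0)
      rcases le_or_gt 0 n with hn | hn
      · have hn' : (0 : ℝ) ≤ n := by exact_mod_cast hn
        nlinarith
      · have hn' : (n : ℝ) ≤ 0 := by exact_mod_cast hn.le
        nlinarith
  have key2 : ∀ m n : ℤ, m * a + n * c < 0 → -1 < m * a + n * c → 0 < m * b + n * d →
      0 ≤ m ∧ 1 ≤ n := by
    intro m n g1 g2 g3
    by_cases hn : 1 ≤ n
    · refine ⟨?_, hn⟩
      by_contra! hm
      have hn' : (1 : ℝ) ≤ n := by exact_mod_cast hn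
      have hm' : (m : ℝ) ≤ -1 := by exact_mod_cast Int.le_sub_one_of_lt hm
      nlinarith
    · exfalso
      have hn' : (n : ℝ) ≤ 0 := by exact_mod_cast (by omega : n ≤ 0)
      rcases le_or_gt 0 m with hm | hm
      · have hm' : (0 : ℝ) ≤ m := by exact_mod_cast hm
        nlinarith
      · have hm' : (m : ℝ) ≤ 0 := by exact_mod_cast hm.le
        nlinarith
  exact ⟨(key p q h1 h2 h5).1, (key p q h1 h2 h5).2, (key2 r s h3 h4 h6).1, (key2 r s h3 h4 h6).2⟩

/-! ### Null sets. -/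

theorem ae_quadratic_ne_zero {A B C : ℝ} (h : A ≠ 0 ∨ B ≠ 0) :
    ∀ᵐ t : ℝ, A * t ^ 2 + B * t + C ≠ 0 := by
  rw [ae_iff]
  simp only [ne_eq, not_not]
  refine Set.Finite.measure_zero ?_ _
  let P : Polynomial ℝ := Polynomial.C A * Polynomial.X ^ 2 + Polynomial.C B * Polynomial.X +
    Polynomial.C C
  have hP : P ≠ 0 := by
    intro h0
    have h1 : P.coeff 1 = B := by simp [P, Polynomial.coeff_C]
    have h2 : P.coeff 2 = A := by simp [P]
    rw [h0] at h1 h2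
    rcases h with h | h
    · exact h h2.symm
    · exact h h1.symm
  refine (P.finite_setOfPred_isRoot hP).subset fun t ht => ?_
  simpa [P, Polynomial.IsRoot] using ht

/-- Fubini along the direction `e`: on each parallel line `f` is a nonzero polynomial and so has
finitely many zeros. -/
theorem ae_ne_zero_of_quadratic_on_lines {f : (Fin 2 → Fin 2 → ℝ) → ℝ} (hf : Continuous f)
    (e : Fin 2 → Fin 2 → ℝ) (A B C : (Fin 2 → Fin 2 → ℝ) → ℝ)
    (h : ∀ M (t : ℝ), f (M + t • e) = A M * t ^ 2 + B M * t + C M)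
    (hAB : ∀ M, A M ≠ 0 ∨ B M ≠ 0) : ∀ᵐ M, f M ≠ 0 := by
  have hmeas : MeasurableSet {M | f M ≠ 0} := (isOpen_ne_fun hf continuous_const).measurableSet
  have := (MeasureTheory.ae_ae_add_linearMap_mem_iff (LinearMap.toSpanSingleton ℝ _ e)
    (volume : Measure ℝ) (volume : Measure (Fin 2 → Fin 2 → ℝ)) hmeas).1
  refine this (Filter.Eventually.of_forall fun M => ?_)
  filter_upwards [ae_quadratic_ne_zero (C := C M) (hAB M)] with t ht
  change f (M + t • e) ≠ 0
  rwa [h]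

theorem ae_coneMeasure_of_ae {p : Matrix.SpecialLinearGroup (Fin 2) ℝ → Prop}
    (hp : MeasurableSet {A | p A}) {q : (Fin 2 → Fin 2 → ℝ) → Prop} (hq : ∀ᵐ M, q M)
    (h : ∀ M, 0 < arrayDet M → q M → p (normalizeDet M)) : ∀ᵐ A ∂coneMeasure, p A := by
  rw [coneMeasure, ae_map_iff measurable_normalizeDet.aemeasurable hp,
    ae_restrict_iff' measurableSet_detUnit]
  filter_upwards [hq] with M hM h0
  exact h M h0.1 hM

@[fun_prop]
theorem continuous_entry (i j : Fin 2) :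
    Continuous fun A : Matrix.SpecialLinearGroup (Fin 2) ℝ => A i j :=
  (continuous_apply_apply i j).comp continuous_entries

/-- The matrix unit with a single entry `1`. -/
def matrixUnit (i j : Fin 2) : Fin 2 → Fin 2 → ℝ := fun k l => if k = i ∧ l = j then 1 else 0

theorem ae_linear_ne_zero (j : Fin 2) {m n : ℝ} (h : m ≠ 0 ∨ n ≠ 0) :
    ∀ᵐ A : Matrix.SpecialLinearGroup (Fin 2) ℝ ∂coneMeasure, m * A 0 j + n * A 1 j ≠ 0 := by
  have hM : ∀ᵐ M : Fin 2 → Fin 2 → ℝ, m * M 0 j + n * M 1 j ≠ 0 := by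
    rcases h with h | h
    · exact ae_ne_zero_of_quadratic_on_lines (by fun_prop) (matrixUnit 0 j) (fun _ => 0)
        (fun _ => m) (fun M => m * M 0 j + n * M 1 j)
        (fun M t => by simp [matrixUnit]; ring) (fun _ => Or.inr h)
    · exact ae_ne_zero_of_quadratic_on_lines (by fun_prop) (matrixUnit 1 j) (fun _ => 0)
        (fun _ => n) (fun M => m * M 0 j + n * M 1 j)
        (fun M t => by simp [matrixUnit]; ring) (fun _ => Or.inr h)
  refine ae_coneMeasure_of_ae (isOpen_ne_fun (by fun_prop) continuous_const).measurableSet hM ?_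
  intro M h0 h1 h2
  rw [normalizeDet_apply h0, normalizeDet_apply h0] at h2
  refine h1 (((mul_eq_zero (a := (√(arrayDet M))⁻¹)).1 ?_).resolve_left
    (inv_ne_zero (Real.sqrt_ne_zero'.2 h0)))
  linear_combination h2

theorem ae_lattice_ne_zero (j : Fin 2) :
    ∀ᵐ A : Matrix.SpecialLinearGroup (Fin 2) ℝ ∂coneMeasure,
      ∀ m n : ℤ, (m ≠ 0 ∨ n ≠ 0) → m * A 0 j + n * A 1 j ≠ 0 := by
  rw [ae_all_iff]; intro m
  rw [ae_all_iff]; intro n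
  by_cases h : m ≠ 0 ∨ n ≠ 0
  · filter_upwards [ae_linear_ne_zero j (m := m) (n := n) (by exact_mod_cast h)] with A hA _
    exact hA
  · exact Filter.Eventually.of_forall fun A h' => absurd h' h

/-- On the cone the excluded equation becomes `(M 0 0 - M 1 0) ^ 2 = arrayDet M`. It describes the
case `u₁ + u₂ = 1`, where the construction of an empty rectangle breaks down. -/
theorem ae_sub_ne_one : ∀ᵐ A : Matrix.SpecialLinearGroup (Fin 2) ℝ ∂coneMeasure,
    A 0 0 - A 1 0 ≠ 1 := by
  have hM : ∀ᵐ M : Fin 2 → Fin 2 → ℝ, (M 0 0 - M 1 0) ^ 2 - arrayDet M ≠ 0 :=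
    ae_ne_zero_of_quadratic_on_lines ((by fun_prop : Continuous fun M : Fin 2 → Fin 2 → ℝ =>
        (M 0 0 - M 1 0) ^ 2).sub continuous_arrayDet) (matrixUnit 0 0) (fun _ => 1)
      (fun M => 2 * (M 0 0 - M 1 0) - M 1 1) (fun M => (M 0 0 - M 1 0) ^ 2 - arrayDet M)
      (fun M t => by simp [matrixUnit, arrayDet]; ring) (fun _ => Or.inl one_ne_zero)
  refine ae_coneMeasure_of_ae (isOpen_ne_fun (by fun_prop) continuous_const).measurableSet hM ?_
  intro M h0 h1 h2
  rw [normalizeDet_apply h0, normalizeDet_apply h0, ← mul_sub, inv_mul_eq_one₀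
    (Real.sqrt_ne_zero'.2 h0)] at h2
  rw [← h2, Real.sq_sqrt h0.le, sub_self] at h1
  exact h1 rfl

theorem ae_quadric_ne_zero (σ : ℝ) (hσ : σ ≠ 0) :
    ∀ᵐ A : Matrix.SpecialLinearGroup (Fin 2) ℝ ∂coneMeasure,
      2 * (A 0 0 * A 1 0 + A 0 1 * A 1 1) ≠ σ * (A 1 0 ^ 2 + A 1 1 ^ 2) := by
  have hM : ∀ᵐ M : Fin 2 → Fin 2 → ℝ, 2 * (M 0 0 * M 1 0 + M 0 1 * M 1 1) -
      σ * (M 1 0 ^ 2 + M 1 1 ^ 2) ≠ 0 :=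
    ae_ne_zero_of_quadratic_on_lines (by fun_prop) (matrixUnit 1 0) (fun _ => -σ)
      (fun M => 2 * M 0 0 - 2 * σ * M 1 0) (fun M => 2 * (M 0 0 * M 1 0 + M 0 1 * M 1 1) -
      σ * (M 1 0 ^ 2 + M 1 1 ^ 2))
      (fun M t => by simp [matrixUnit]; ring) (fun _ => Or.inl (neg_ne_zero.2 hσ))
  refine ae_coneMeasure_of_ae (isOpen_ne_fun (by fun_prop) (by fun_prop)).measurableSet hM ?_
  intro M h0 h1 h2
  simp only [normalizeDet_apply h0] at h2
  refine h1 (((mul_eq_zero (a := (√(arrayDet M))⁻¹ ^ 2)).1 ?_).resolve_left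
    (pow_ne_zero 2 (inv_ne_zero (Real.sqrt_ne_zero'.2 h0))))
  linear_combination h2

theorem ae_row_norms_ne :
    ∀ᵐ A : Matrix.SpecialLinearGroup (Fin 2) ℝ ∂coneMeasure,
      A 0 0 ^ 2 + A 0 1 ^ 2 ≠ A 1 0 ^ 2 + A 1 1 ^ 2 := by
  have hM : ∀ᵐ M : Fin 2 → Fin 2 → ℝ,
      M 0 0 ^ 2 + M 0 1 ^ 2 - (M 1 0 ^ 2 + M 1 1 ^ 2) ≠ 0 :=
    ae_ne_zero_of_quadratic_on_lines (by fun_prop) (matrixUnit 0 0) (fun _ => 1)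
      (fun M => 2 * M 0 0) (fun M => M 0 0 ^ 2 + M 0 1 ^ 2 - (M 1 0 ^ 2 + M 1 1 ^ 2))
      (fun M t => by simp [matrixUnit]; ring) (fun _ => Or.inl one_ne_zero)
  refine ae_coneMeasure_of_ae (isOpen_ne_fun (by fun_prop) (by fun_prop)).measurableSet hM ?_
  intro M h0 h1 h2
  simp only [normalizeDet_apply h0] at h2
  refine h1 (((mul_eq_zero (a := (√(arrayDet M))⁻¹ ^ 2)).1 ?_).resolve_left
    (pow_ne_zero 2 (inv_ne_zero (Real.sqrt_ne_zero'.2 h0))))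
  linear_combination h2

/-! ### Fundamental domains for `SL(2, ℤ)`. -/

/-- The image of `SL(2, ℤ)` in `SL(2, ℝ)`. -/
def integerSubgroup : Subgroup (Matrix.SpecialLinearGroup (Fin 2) ℝ) :=
  (Matrix.SpecialLinearGroup.map (n := Fin 2) (Int.castRingHom ℝ)).range

instance : Countable (Matrix.SpecialLinearGroup (Fin 2) ℤ) :=
  haveI : Countable (Matrix (Fin 2) (Fin 2) ℤ) := inferInstanceAs (Countable (Fin 2 → Fin 2 → ℤ))
  inferInstanceAs (Countable {A : Matrix (Fin 2) (Fin 2) ℤ // A.det = 1})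

instance : Countable integerSubgroup :=
  (Set.countable_range (Matrix.SpecialLinearGroup.map (n := Fin 2) (Int.castRingHom ℝ))).to_subtype

theorem integer_mul_apply (g : Matrix.SpecialLinearGroup (Fin 2) ℤ)
    (A : Matrix.SpecialLinearGroup (Fin 2) ℝ) (i j : Fin 2) :
    (Matrix.SpecialLinearGroup.map (Int.castRingHom ℝ) g * A) i j =
      g i 0 * A 0 j + g i 1 * A 1 j := by
  rw [specialLinearGroup_mul_apply]
  rfl

/-- The matrices whose rows form the basis adapted to the vertical strip of width one. -/
def stripDomain : Set (Matrix.SpecialLinearGroup (Fin 2) ℝ) :=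
  {A | 0 < A 0 0 ∧ A 0 0 < 1 ∧ A 1 0 < 0 ∧ -1 < A 1 0 ∧ 1 ≤ A 0 0 - A 1 0 ∧
    0 < A 0 1 ∧ 0 < A 1 1}

theorem measurableSet_stripDomain : MeasurableSet stripDomain := by
  have h : ∀ i j, Measurable fun A : Matrix.SpecialLinearGroup (Fin 2) ℝ => A i j :=
    fun i j => (continuous_entry i j).measurable
  exact (measurableSet_lt measurable_const (h 0 0)).inter <|
    (measurableSet_lt (h 0 0) measurable_const).inter <|
    (measurableSet_lt (h 1 0) measurable_const).inter <|
    (measurableSet_lt measurable_const (h 1 0)).inter <|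
    (measurableSet_le measurable_const ((h 0 0).sub (h 1 0))).inter <|
    (measurableSet_lt measurable_const (h 0 1)).inter (measurableSet_lt measurable_const (h 1 1))

/-- By `strip_basis_unique` both `g` and `g⁻¹` have nonnegative entries. In `SL(2)` inversion
negates the off-diagonal entries, so these vanish, and the positive diagonal entries have product
one. -/
theorem eq_one_of_mem_stripDomain {A : Matrix.SpecialLinearGroup (Fin 2) ℝ} (hA : A ∈ stripDomain)
    {g : Matrix.SpecialLinearGroup (Fin 2) ℤ}
    (hg : Matrix.SpecialLinearGroup.map (Int.castRingHom ℝ) g * A ∈ stripDomain) : g = 1 := by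
  have key : ∀ (A : Matrix.SpecialLinearGroup (Fin 2) ℝ) (g : Matrix.SpecialLinearGroup (Fin 2) ℤ),
      A ∈ stripDomain → Matrix.SpecialLinearGroup.map (Int.castRingHom ℝ) g * A ∈ stripDomain →
      1 ≤ g 0 0 ∧ 0 ≤ g 0 1 ∧ 0 ≤ g 1 0 ∧ 1 ≤ g 1 1 := by
    rintro A g ⟨a1, -, a3, -, a5, a6, a7⟩ ⟨b1, b2, b3, b4, -, b6, b7⟩
    simp only [integer_mul_apply] at b1 b2 b3 b4 b6 b7
    exact strip_basis_unique a1 a3 a5 a6 a7 b1 b2 b3 b4 b6 b7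
  obtain ⟨h1, h2, h3, h4⟩ := key A g hA hg
  have h5 := key _ g⁻¹ hg (by rwa [map_inv, inv_mul_cancel_left])
  rw [Matrix.SpecialLinearGroup.SL2_inv_expl] at h5
  have h6 : 0 ≤ -g 0 1 := h5.2.1
  have h7 : 0 ≤ -g 1 0 := h5.2.2.1
  have hdet : g 0 0 * g 1 1 - g 0 1 * g 1 0 = 1 := by
    rw [← Matrix.det_fin_two, g.det_coe]
  have h8 : g 0 1 = 0 := by omega
  have h9 : g 1 0 = 0 := by omega
  rw [h8, h9] at hdet
  have h10 : g 0 0 = 1 := by nlinarith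
  have h11 : g 1 1 = 1 := by nlinarith
  ext i j
  fin_cases i <;> fin_cases j <;> simp [h8, h9, h10, h11]

theorem isFundamentalDomain_of_unique {s : Set (Matrix.SpecialLinearGroup (Fin 2) ℝ)}
    (hs : MeasurableSet s)
    (hcover : ∀ᵐ A ∂coneMeasure, ∃ g : Matrix.SpecialLinearGroup (Fin 2) ℤ,
      Matrix.SpecialLinearGroup.map (Int.castRingHom ℝ) g * A ∈ s)
    (huniq : ∀ A ∈ s, ∀ g : Matrix.SpecialLinearGroup (Fin 2) ℤ,
      Matrix.SpecialLinearGroup.map (Int.castRingHom ℝ) g * A ∈ s → g = 1) :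
    IsFundamentalDomain integerSubgroup s coneMeasure where
  nullMeasurableSet := hs.nullMeasurableSet
  ae_covers := by
    filter_upwards [hcover] with A hA
    obtain ⟨g, hg⟩ := hA
    exact ⟨⟨_, g, rfl⟩, hg⟩
  aedisjoint := by
    intro a b hab
    refine Disjoint.aedisjoint (Set.disjoint_left.2 fun A ha hb => hab ?_)
    rw [Set.mem_smul_set_iff_inv_smul_mem] at ha hb
    obtain ⟨g, hg⟩ := (b⁻¹ * a).2
    have h1 : Matrix.SpecialLinearGroup.map (Int.castRingHom ℝ) g * (a⁻¹ • A) ∈ s := by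
      rw [hg]
      change (b⁻¹ * a : integerSubgroup) • (a⁻¹ • A) ∈ s
      rwa [smul_smul, mul_inv_cancel_right]
    have h2 := huniq _ ha g h1
    rw [h2, map_one] at hg
    have h3 : b⁻¹ * a = 1 := Subtype.ext hg.symm
    exact (inv_mul_eq_one.1 h3).symm

theorem isFundamentalDomain_stripDomain :
    IsFundamentalDomain integerSubgroup stripDomain coneMeasure := by
  refine isFundamentalDomain_of_unique measurableSet_stripDomain ?_
    fun A hA g hg => eq_one_of_mem_stripDomain hA hg
  filter_upwards [ae_lattice_ne_zero 0, ae_lattice_ne_zero 1] with A hx hy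
  obtain ⟨p, q, r, s, hdet, h1, h2, h3, h4, h5, h6, h7⟩ :=
    exists_strip_basis (specialLinearGroup_det_eq A) hx hy
  let g : Matrix.SpecialLinearGroup (Fin 2) ℤ :=
    ⟨!![p, q; r, s], by simp [Matrix.det_fin_two, hdet]⟩
  refine ⟨g, ?_⟩
  simp only [stripDomain, Set.mem_ofPred_eq, integer_mul_apply]
  exact ⟨h1, h2, h3, h4, h5, h6, h7⟩

theorem bottom_row_norm_pos (A : Matrix.SpecialLinearGroup (Fin 2) ℝ) :
    0 < A 1 0 ^ 2 + A 1 1 ^ 2 := by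
  have h := specialLinearGroup_det_eq A
  by_contra! h0
  have h1 : A 1 0 = 0 := by nlinarith [sq_nonneg (A 1 0), sq_nonneg (A 1 1)]
  have h2 : A 1 1 = 0 := by nlinarith [sq_nonneg (A 1 0), sq_nonneg (A 1 1)]
  rw [h1, h2] at h
  norm_num at h

theorem coe_smul_I (A : Matrix.SpecialLinearGroup (Fin 2) ℝ) :
    ((A • UpperHalfPlane.I : UpperHalfPlane) : ℂ) =
      (A 0 0 * Complex.I + A 0 1) / (A 1 0 * Complex.I + A 1 1) := by
  rw [UpperHalfPlane.coe_specialLinearGroup_apply]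
  rfl

theorem normSq_smul_I (A : Matrix.SpecialLinearGroup (Fin 2) ℝ) :
    Complex.normSq (A • UpperHalfPlane.I : UpperHalfPlane) =
      (A 0 0 ^ 2 + A 0 1 ^ 2) / (A 1 0 ^ 2 + A 1 1 ^ 2) := by
  rw [coe_smul_I, Complex.normSq_div]
  simp [Complex.normSq_apply]
  ring

theorem re_smul_I (A : Matrix.SpecialLinearGroup (Fin 2) ℝ) :
    (A • UpperHalfPlane.I : UpperHalfPlane).re =
      (A 0 0 * A 1 0 + A 0 1 * A 1 1) / (A 1 0 ^ 2 + A 1 1 ^ 2) := by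
  rw [← UpperHalfPlane.coe_re, coe_smul_I, Complex.div_re]
  simp [Complex.normSq_apply]
  ring

theorem smul_I_mem_fd_iff (A : Matrix.SpecialLinearGroup (Fin 2) ℝ) :
    A • UpperHalfPlane.I ∈ ModularGroup.fd ↔ A 1 0 ^ 2 + A 1 1 ^ 2 ≤ A 0 0 ^ 2 + A 0 1 ^ 2 ∧
      |2 * (A 0 0 * A 1 0 + A 0 1 * A 1 1)| ≤ A 1 0 ^ 2 + A 1 1 ^ 2 := by
  have h := bottom_row_norm_pos A
  change 1 ≤ Complex.normSq (A • UpperHalfPlane.I : UpperHalfPlane) ∧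
    |(A • UpperHalfPlane.I : UpperHalfPlane).re| ≤ 1 / 2 ↔ _
  rw [normSq_smul_I, re_smul_I, one_le_div h, abs_div, abs_of_pos h, div_le_iff₀ h, abs_mul, abs_two]
  refine and_congr_right fun _ => ⟨fun h => ?_, fun h => ?_⟩ <;> linarith

theorem smul_I_mem_fdo_iff (A : Matrix.SpecialLinearGroup (Fin 2) ℝ) :
    A • UpperHalfPlane.I ∈ ModularGroup.fdo ↔ A 1 0 ^ 2 + A 1 1 ^ 2 < A 0 0 ^ 2 + A 0 1 ^ 2 ∧
      |2 * (A 0 0 * A 1 0 + A 0 1 * A 1 1)| < A 1 0 ^ 2 + A 1 1 ^ 2 := by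
  have h := bottom_row_norm_pos A
  change 1 < Complex.normSq (A • UpperHalfPlane.I : UpperHalfPlane) ∧
    |(A • UpperHalfPlane.I : UpperHalfPlane).re| < 1 / 2 ↔ _
  rw [normSq_smul_I, re_smul_I, one_lt_div h, abs_div, abs_of_pos h, div_lt_iff₀ h, abs_mul, abs_two]
  refine and_congr_right fun _ => ⟨fun h => ?_, fun h => ?_⟩ <;> linarith

theorem map_int_smul (g : Matrix.SpecialLinearGroup (Fin 2) ℤ) (z : UpperHalfPlane) :
    Matrix.SpecialLinearGroup.map (Int.castRingHom ℝ) g • z = g • z := by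
  ext
  rw [UpperHalfPlane.coe_specialLinearGroup_apply, UpperHalfPlane.coe_specialLinearGroup_apply]
  simp

/-- The matrices moving `i` into the interior of the modular domain, with a sign condition which
singles out one of `± A`. -/
def halfModularDomain : Set (Matrix.SpecialLinearGroup (Fin 2) ℝ) :=
  {A | A • UpperHalfPlane.I ∈ ModularGroup.fdo ∧ 0 < A 1 0}

theorem measurableSet_halfModularDomain : MeasurableSet halfModularDomain := by
  have h : halfModularDomain = {A | (A 1 0 ^ 2 + A 1 1 ^ 2 < A 0 0 ^ 2 + A 0 1 ^ 2 ∧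
      |2 * (A 0 0 * A 1 0 + A 0 1 * A 1 1)| < A 1 0 ^ 2 + A 1 1 ^ 2) ∧ 0 < A 1 0} :=
    Set.ext fun A => and_congr_left fun _ => smul_I_mem_fdo_iff A
  rw [h]
  change MeasurableSet (({A : Matrix.SpecialLinearGroup (Fin 2) ℝ |
      A 1 0 ^ 2 + A 1 1 ^ 2 < A 0 0 ^ 2 + A 0 1 ^ 2} ∩
    {A | |2 * (A 0 0 * A 1 0 + A 0 1 * A 1 1)| < A 1 0 ^ 2 + A 1 1 ^ 2}) ∩ {A | 0 < A 1 0})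
  exact (((isOpen_lt (by fun_prop) (by fun_prop)).inter
    (isOpen_lt (by fun_prop) (by fun_prop))).inter
    (isOpen_lt continuous_const (by fun_prop))).measurableSet

/-- The boundary of the modular domain consists of the unit circle and the lines `Re z = ±1/2`,
which pull back to quadrics in the entries of `A`. -/
theorem ae_mem_fdo_of_mem_fd : ∀ᵐ A ∂coneMeasure, A 1 0 ≠ 0 ∧
    (A • UpperHalfPlane.I ∈ ModularGroup.fd → A • UpperHalfPlane.I ∈ ModularGroup.fdo) := by
  filter_upwards [ae_lattice_ne_zero 0, ae_row_norms_ne, ae_quadric_ne_zero 1 one_ne_zero,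
    ae_quadric_ne_zero (-1) (by norm_num)] with A h1 h2 h3 h4
  refine ⟨by simpa using h1 0 1 (by simp), ?_⟩
  rw [smul_I_mem_fd_iff, smul_I_mem_fdo_iff]
  rintro ⟨h5, h6⟩
  refine ⟨lt_of_le_of_ne h5 h2.symm, lt_of_le_of_ne h6 fun h7 => ?_⟩
  rcases (abs_eq (bottom_row_norm_pos A).le).1 h7 with h | h
  · exact h3 (by linarith)
  · exact h4 (by linarith)

theorem neg_smul_I (A : Matrix.SpecialLinearGroup (Fin 2) ℝ) :
    -A • UpperHalfPlane.I = A • UpperHalfPlane.I := by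
  ext
  rw [coe_smul_I, coe_smul_I]
  have h : ∀ i j, (-A) i j = -(A i j) := fun i j => by simp
  simp only [h]
  push_cast
  rw [neg_mul, neg_mul, ← neg_add, ← neg_add, neg_div_neg_eq]

theorem map_int_neg (g : Matrix.SpecialLinearGroup (Fin 2) ℤ) :
    Matrix.SpecialLinearGroup.map (Int.castRingHom ℝ) (-g) =
      -Matrix.SpecialLinearGroup.map (Int.castRingHom ℝ) g := by
  ext i j
  simp

theorem isFundamentalDomain_halfModularDomain :
    IsFundamentalDomain integerSubgroup halfModularDomain coneMeasure := by
  refine isFundamentalDomain_of_unique measurableSet_halfModularDomain ?_ ?_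
  · have hae : ∀ᵐ A ∂coneMeasure, ∀ g : Matrix.SpecialLinearGroup (Fin 2) ℤ,
        let B := Matrix.SpecialLinearGroup.map (Int.castRingHom ℝ) g * A
        B 1 0 ≠ 0 ∧
          (B • UpperHalfPlane.I ∈ ModularGroup.fd → B • UpperHalfPlane.I ∈ ModularGroup.fdo) :=
      ae_all_iff.2 fun g =>
        (measurePreserving_mul_left coneMeasure _).quasiMeasurePreserving.ae ae_mem_fdo_of_mem_fd
    filter_upwards [hae] with A hA
    obtain ⟨g, hg⟩ := ModularGroup.exists_smul_mem_fd (A • UpperHalfPlane.I)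
    rw [← map_int_smul, smul_smul] at hg
    obtain ⟨h1, h2⟩ := hA g
    rcases lt_or_gt_of_ne h1 with h | h
    · refine ⟨-g, ?_, ?_⟩
      · rw [map_int_neg, neg_mul, neg_smul_I]
        exact h2 hg
      · rw [map_int_neg, neg_mul, Matrix.SpecialLinearGroup.coe_neg, Matrix.neg_apply]
        exact neg_pos.2 h
    · exact ⟨g, h2 hg, h⟩
  · rintro A ⟨hA, hpos⟩ g ⟨hg, hpos'⟩
    rw [mul_smul, map_int_smul] at hg
    refine (ModularGroup.eq_one_or_neg_one_of_mem_fdo_mem_fdo hA hg).resolve_right ?_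
    rintro rfl
    rw [map_int_neg, map_one, neg_mul, one_mul, Matrix.SpecialLinearGroup.coe_neg,
      Matrix.neg_apply] at hpos'
    linarith

theorem neg_one_mem_integerSubgroup : (-1 : Matrix.SpecialLinearGroup (Fin 2) ℝ) ∈ integerSubgroup :=
  ⟨-1, by rw [map_int_neg, map_one]⟩

/-- Up to a null set `modularDomain` is the disjoint union of `halfModularDomain` and its negative.
An invariant set has the same measure in every fundamental domain, hence the factor `2`. -/
theorem coneMeasure_inter_modularDomain {E : Set (Matrix.SpecialLinearGroup (Fin 2) ℝ)}
    (hE : MeasurableSet E) (hinv : ∀ g : integerSubgroup, (fun A => g • A) ⁻¹' E = E) :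
    coneMeasure (E ∩ modularDomain) = 2 * coneMeasure (E ∩ stripDomain) := by
  have hneg : ∀ A, -A ∈ E ↔ A ∈ E := fun A => by
    have h := Set.ext_iff.1 (hinv ⟨-1, neg_one_mem_integerSubgroup⟩) A
    have h2 : (-1 : Matrix.SpecialLinearGroup (Fin 2) ℝ) * A ∈ E ↔ A ∈ E := h
    rwa [neg_mul, one_mul] at h2
  set N : Set (Matrix.SpecialLinearGroup (Fin 2) ℝ) := (fun A => -1 * A) ⁻¹' (E ∩ halfModularDomain)
    with hN
  have hunion : (E ∩ modularDomain : Set _) =ᵐ[coneMeasure]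
      (E ∩ halfModularDomain ∪ N : Set _) := by
    rw [Filter.eventuallyEq_set]
    filter_upwards [ae_mem_fdo_of_mem_fd] with A hA
    simp only [hN, Set.mem_inter_iff, Set.mem_union, Set.mem_preimage, neg_mul, one_mul, hneg,
      modularDomain, halfModularDomain, Set.mem_ofPred_eq, neg_smul_I,
      Matrix.SpecialLinearGroup.coe_neg, Matrix.neg_apply]
    constructor
    · rintro ⟨h1, h2⟩
      rcases lt_or_gt_of_ne hA.1 with h | h
      · exact Or.inr ⟨h1, hA.2 h2, neg_pos.2 h⟩
      · exact Or.inl ⟨h1, hA.2 h2, h⟩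
    · rintro (⟨h1, h2, -⟩ | ⟨h1, h2, -⟩) <;> exact ⟨h1, ModularGroup.fdo_subset_fd h2⟩
  have hdisj : Disjoint (E ∩ halfModularDomain) N := by
    refine Set.disjoint_left.2 ?_
    rintro A ⟨-, -, h1⟩ ⟨-, -, h2⟩
    simp only [neg_mul, one_mul, Matrix.SpecialLinearGroup.coe_neg, Matrix.neg_apply] at h2
    linarith
  have hmeas := hE.inter measurableSet_halfModularDomain
  rw [measure_congr hunion, measure_union hdisj (measurable_const_mul _ hmeas), hN,
    measure_preimage_mul, ← two_mul,
    isFundamentalDomain_halfModularDomain.measure_set_eq isFundamentalDomain_stripDomain hE hinv]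

/-- Normalising by the total mass cancels both the factor `2` and the unknown constant between cone
measure and Haar measure. -/
theorem haar_modularDomain_ratio {E : Set (Matrix.SpecialLinearGroup (Fin 2) ℝ)}
    (hE : MeasurableSet E) (hinv : ∀ g : integerSubgroup, (fun A => g • A) ⁻¹' E = E)
    (h0 : coneMeasure stripDomain ≠ 0) :
    ((Measure.haar : Measure (Matrix.SpecialLinearGroup (Fin 2) ℝ)) modularDomain)⁻¹ *
      (Measure.haar : Measure (Matrix.SpecialLinearGroup (Fin 2) ℝ)) (E ∩ modularDomain) =
      (coneMeasure stripDomain)⁻¹ * coneMeasure (E ∩ stripDomain) := by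
  obtain ⟨c, hc⟩ := exists_coneMeasure_eq_smul_haar
  have hc0 : (c : ℝ≥0∞) ≠ 0 := by
    intro h
    rw [ENNReal.coe_eq_zero] at h
    rw [hc, h] at h0
    simp at h0
  have h1 := coneMeasure_inter_modularDomain hE hinv
  have h2 := coneMeasure_inter_modularDomain MeasurableSet.univ (fun g => Set.preimage_univ)
  rw [Set.univ_inter, Set.univ_inter] at h2
  have h3 : ∀ S, coneMeasure S =
      c * (Measure.haar : Measure (Matrix.SpecialLinearGroup (Fin 2) ℝ)) S := fun S => by
    rw [hc]; rfl
  rw [h3 (E ∩ modularDomain)] at h1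
  rw [h3 modularDomain] at h2
  have h4 : ∀ x y z w : ℝ≥0∞, c * x = 2 * y → c * z = 2 * w → x⁻¹ * z = y⁻¹ * w := by
    intro x y z w hxy hzw
    have h5 : x⁻¹ * z = (c * x)⁻¹ * (c * z) := by
      rw [ENNReal.mul_inv (Or.inl hc0) (Or.inl ENNReal.coe_ne_top), mul_mul_mul_comm,
        ENNReal.inv_mul_cancel hc0 ENNReal.coe_ne_top, one_mul]
    rw [h5, hxy, hzw, ENNReal.mul_inv (Or.inl two_ne_zero) (Or.inl ENNReal.ofNat_ne_top),
      mul_mul_mul_comm, ENNReal.inv_mul_cancel two_ne_zero ENNReal.ofNat_ne_top, one_mul]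
  exact h4 _ _ _ _ h2 h1

/-! ### Lattices whose translated diamonds fail to cover. -/

theorem mem_smul_crossPolytope_iff {r : ℝ} (hr : 0 < r) (z : Fin 2 → ℝ) :
    z ∈ r • crossPolytope 2 ↔ |z 0| + |z 1| ≤ r := by
  rw [Set.mem_smul_set_iff_inv_smul_mem₀ hr.ne']
  change ∑ i, |(r⁻¹ • z) i| ≤ 1 ↔ _
  simp only [Fin.sum_univ_two, Pi.smul_apply, smul_eq_mul, abs_mul, abs_inv, abs_of_pos hr]
  rw [← mul_add, inv_mul_le_iff₀ hr, mul_one]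

theorem mem_rowLattice_iff (A : Matrix.SpecialLinearGroup (Fin 2) ℝ) (z : Fin 2 → ℝ) :
    z ∈ (rowLattice A).toSubmodule ↔
      ∃ m n : ℤ, z = fun j => m * A 0 j + n * A 1 j := by
  change z ∈ Submodule.span ℤ (Set.range A.1.row) ↔ _
  rw [Submodule.mem_span_range_iff_exists_fun]
  constructor
  · rintro ⟨c, rfl⟩
    refine ⟨c 0, c 1, ?_⟩
    funext j
    simp [Fin.sum_univ_two, Matrix.row]
  · rintro ⟨m, n, rfl⟩
    refine ⟨![m, n], ?_⟩
    funext j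
    simp [Fin.sum_univ_two, Matrix.row]

/-- The matrices `A` for which the translates of `r𝔓` by `ℤ² A` fail to cover the plane. -/
def uncovered (r : ℝ) : Set (Matrix.SpecialLinearGroup (Fin 2) ℝ) :=
  {A | ∃ x y : ℝ, ∀ m n : ℤ,
    r < |x - (m * A 0 0 + n * A 1 0)| + |y - (m * A 0 1 + n * A 1 1)|}

theorem mem_uncovered_iff {r : ℝ} (hr : 0 < r) (A : Matrix.SpecialLinearGroup (Fin 2) ℝ) :
    A ∈ uncovered r ↔
      ¬ r • crossPolytope 2 + ((rowLattice A).toSubmodule : Set (Fin 2 → ℝ)) = Set.univ := by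
  rw [Set.eq_univ_iff_forall, not_forall]
  constructor
  · rintro ⟨x, y, h⟩
    refine ⟨![x, y], ?_⟩
    rintro ⟨p, hp, l, hl, hpl⟩
    obtain ⟨m, n, rfl⟩ := (mem_rowLattice_iff A l).1 hl
    rw [mem_smul_crossPolytope_iff hr] at hp
    have h0 := congrFun hpl 0
    have h1 := congrFun hpl 1
    simp only [Pi.add_apply, Matrix.cons_val_zero, Matrix.cons_val_one] at h0 h1
    refine absurd (h m n) (not_lt.2 ?_)
    rwa [← h0, ← h1, add_sub_cancel_right, add_sub_cancel_right]
  · rintro ⟨z, hz⟩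
    refine ⟨z 0, z 1, fun m n => ?_⟩
    by_contra! h
    refine hz ⟨z - fun j => m * A 0 j + n * A 1 j, ?_, _, (mem_rowLattice_iff A _).2 ⟨m, n, rfl⟩,
      sub_add_cancel _ _⟩
    rw [mem_smul_crossPolytope_iff hr]
    exact h

/-- For a fixed uncovered point, only finitely many coefficient pairs `(m, n)` can violate the
inequality, uniformly for `B` near `A`; each of these finitely many strict inequalities is an open
condition. -/
theorem isOpen_uncovered (r : ℝ) : IsOpen (uncovered r) := by
  have hset : uncovered r = ⋃ x : ℝ, ⋃ y : ℝ, {A | ∀ m n : ℤ,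
      r < |x - (m * A 0 0 + n * A 1 0)| + |y - (m * A 0 1 + n * A 1 1)|} := by
    ext A
    simp [uncovered]
  rw [hset]
  refine isOpen_iUnion fun x => isOpen_iUnion fun y => isOpen_iff_mem_nhds.2 fun A hA => ?_
  have hent : ∀ i j, ∀ᶠ B : Matrix.SpecialLinearGroup (Fin 2) ℝ in nhds A, |B i j| < |A i j| + 1 :=
    fun i j => (continuous_entry i j).abs.continuousAt.eventually_lt continuousAt_const (by simp)
  set K : ℝ := |A 0 0| + |A 0 1| + |A 1 0| + |A 1 1| + 1 with hK
  set N : ℤ := ⌈(|r| + |x| + |y|) * K⌉ with hN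
  have hfin : ∀ᶠ B : Matrix.SpecialLinearGroup (Fin 2) ℝ in nhds A,
      ∀ z ∈ (Set.Icc (-N) N) ×ˢ (Set.Icc (-N) N),
        r < |x - (z.1 * B 0 0 + z.2 * B 1 0)| + |y - (z.1 * B 0 1 + z.2 * B 1 1)| := by
    refine (Filter.eventually_all_finite ((Set.finite_Icc _ _).prod (Set.finite_Icc _ _))).2 ?_
    intro z _
    exact continuousAt_const.eventually_lt (Continuous.continuousAt (by fun_prop)) (hA z.1 z.2)
  filter_upwards [hfin, hent 0 0, hent 0 1, hent 1 0, hent 1 1] with B hB h00 h01 h10 h11 m n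
  by_contra! h
  set X : ℝ := m * B 0 0 + n * B 1 0 with hX
  set Y : ℝ := m * B 0 1 + n * B 1 1 with hY
  have hdet := specialLinearGroup_det_eq B
  have h1 : |X| + |Y| ≤ |r| + |x| + |y| := by
    have e1 := abs_sub_abs_le_abs_sub X x
    have e2 := abs_sub_abs_le_abs_sub Y y
    rw [abs_sub_comm] at e1 e2
    have e3 := le_abs_self r
    linarith
  -- Cramer's rule: both coefficients are combinations of `X` and `Y` with entries of `B` as
  -- weights.
  have hbound : ∀ (k : ℤ) (s t : ℝ), |s| ≤ K → |t| ≤ K → (k : ℝ) = X * s - Y * t →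
      k ∈ Set.Icc (-N) N := by
    intro k s t hs ht hk
    have hK0 : 0 ≤ K := (abs_nonneg s).trans hs
    have e1 : |(k : ℝ)| ≤ (|r| + |x| + |y|) * K := by
      rw [hk]
      calc _ ≤ |X| * |s| + |Y| * |t| := by
            rw [← abs_mul, ← abs_mul]; exact abs_sub _ _
        _ ≤ |X| * K + |Y| * K := by gcongr
        _ = (|X| + |Y|) * K := by ring
        _ ≤ _ := by gcongr
    have e2 := abs_le.1 (e1.trans (Int.le_ceil _))
    exact ⟨by exact_mod_cast e2.1, by exact_mod_cast e2.2⟩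
  have p00 := abs_nonneg (A 0 0)
  have p01 := abs_nonneg (A 0 1)
  have p10 := abs_nonneg (A 1 0)
  have p11 := abs_nonneg (A 1 1)
  have hm := hbound m (B 1 1) (B 1 0) (by linarith) (by linarith)
    (by rw [hX, hY]; linear_combination (-(m : ℝ)) * hdet)
  have hn := hbound n (-B 0 1) (-B 0 0) (by rw [abs_neg]; linarith) (by rw [abs_neg]; linarith)
    (by rw [hX, hY]; linear_combination (-(n : ℝ)) * hdet)
  exact absurd (hB (m, n) ⟨hm, hn⟩) (not_lt.2 h)

theorem mul_mem_uncovered_of_mem {r : ℝ} {A : Matrix.SpecialLinearGroup (Fin 2) ℝ}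
    (hA : A ∈ uncovered r) (g : integerSubgroup) : g • A ∈ uncovered r := by
  obtain ⟨G, g, rfl⟩ := g
  obtain ⟨x, y, h⟩ := hA
  refine ⟨x, y, fun m n => ?_⟩
  change r < |x - (m * (Matrix.SpecialLinearGroup.map (Int.castRingHom ℝ) g * A) 0 0 +
    n * (Matrix.SpecialLinearGroup.map (Int.castRingHom ℝ) g * A) 1 0)| +
    |y - (m * (Matrix.SpecialLinearGroup.map (Int.castRingHom ℝ) g * A) 0 1 +
    n * (Matrix.SpecialLinearGroup.map (Int.castRingHom ℝ) g * A) 1 1)|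
  simp only [integer_mul_apply]
  convert h (m * g 0 0 + n * g 1 0) (m * g 0 1 + n * g 1 1) using 4 <;> push_cast <;> ring

theorem preimage_smul_uncovered (r : ℝ) (g : integerSubgroup) :
    (fun A => g • A) ⁻¹' uncovered r = uncovered r := by
  ext A
  refine ⟨fun h => ?_, fun h => mul_mem_uncovered_of_mem h g⟩
  have := mul_mem_uncovered_of_mem h g⁻¹
  rwa [inv_smul_smul] at this

/-! ### Lattice points in rectangles of width one. -/

/-- A walk through a strip of width `s = u₁ + u₂`: from abscissa `X`, add `(-u₂, v₂)` if this stays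
in the strip and `(u₁, v₁)` otherwise. The number of steps is `N = m + n`. By `hid`, `s` times the
height is `N` up to a bounded error, so there is a last point of height at most `e + T`. -/
theorem exists_lattice_point_in_rectangle {u₁ u₂ v₁ v₂ T : ℝ} (hu₁ : 0 < u₁) (hu₁' : u₁ < 1)
    (hu₂ : 0 < u₂) (hu₂' : u₂ < 1) (hv₁ : 0 < v₁) (hv₂ : 0 < v₂) (hdet : u₁ * v₂ + v₁ * u₂ = 1)
    (hT : v₁ + v₂ ≤ T) (c e : ℝ) :
    ∃ m n : ℤ, c ≤ m * u₁ - n * u₂ ∧ m * u₁ - n * u₂ ≤ c + 1 ∧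
      e ≤ m * v₁ + n * v₂ ∧ m * v₁ + n * v₂ ≤ e + T := by
  set s := u₁ + u₂ with hs
  have hs0 : 0 < s := add_pos hu₁ hu₂
  let P : ℤ → Prop := fun N => ∃ m : ℤ, c ≤ m * s - N * u₂ ∧ m * s - N * u₂ < c + s ∧
    m * v₁ + (N - m) * v₂ ≤ e + T
  have hid : ∀ (N m : ℤ), s * (m * v₁ + (N - m) * v₂) = N + (v₁ - v₂) * (m * s - N * u₂) := by
    intro N m
    rw [hs]
    linear_combination (N : ℝ) * hdet
  have hprod : ∀ X : ℝ, c ≤ X → X < c + s → |(v₁ - v₂) * X| ≤ |v₁ - v₂| * (|c| + s) := by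
    intro X h1 h2
    rw [abs_mul]
    refine mul_le_mul_of_nonneg_left ?_ (abs_nonneg _)
    rw [abs_le]
    constructor <;> linarith [le_abs_self c, neg_abs_le c]
  have hbdd : ∃ b : ℤ, ∀ N, P N → N ≤ b := by
    refine ⟨⌈s * (e + T) + |v₁ - v₂| * (|c| + s)⌉, ?_⟩
    rintro N ⟨m, h1, h2, h3⟩
    have h4 := hid N m
    have h5 := (abs_le.1 (hprod _ h1 h2)).1
    have h6 := mul_le_mul_of_nonneg_left h3 hs0.le
    have h7 : (N : ℝ) ≤ s * (e + T) + |v₁ - v₂| * (|c| + s) := by linarith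
    exact_mod_cast h7.trans (Int.le_ceil _)
  have hne : ∃ N, P N := by
    set N : ℤ := ⌊s * (e + T) - |v₁ - v₂| * (|c| + s)⌋ with hN
    have hm1 := Int.le_ceil ((c + N * u₂) / s)
    have hm2 := Int.ceil_lt_add_one ((c + N * u₂) / s)
    set m : ℤ := ⌈(c + N * u₂) / s⌉
    rw [div_le_iff₀ hs0] at hm1
    rw [← sub_lt_iff_lt_add, lt_div_iff₀ hs0] at hm2
    have h1 : c ≤ m * s - N * u₂ := by linarith
    have h2 : m * s - N * u₂ < c + s := by linarith
    refine ⟨N, m, h1, h2, ?_⟩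
    have h3 := (abs_le.1 (hprod _ h1 h2)).2
    have h4 := hid N m
    have h5 : (N : ℝ) ≤ s * (e + T) - |v₁ - v₂| * (|c| + s) := Int.floor_le _
    refine le_of_mul_le_mul_left ?_ hs0
    linarith
  obtain ⟨N, ⟨m, h1, h2, h3⟩, hmax⟩ := Int.exists_greatest_of_bdd hbdd hne
  have hX : (m : ℝ) * s - N * u₂ = m * u₁ - (N - m : ℤ) * u₂ := by rw [hs]; push_cast; ring
  -- By maximality the next step of the walk rises above `e + T`, so the current height exceeds `e`.
  -- If the point lies in the excess part `X > c + 1` of the wider strip, moving back by `(u₁, v₁)`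
  -- brings it into the rectangle, still above `e` because `v₁ + v₂ ≤ T`.
  rcases le_or_gt c (m * s - N * u₂ - u₂) with h4 | h4
  · have h5 : e + T < m * v₁ + (N - m) * v₂ + v₂ := by
      by_contra! h
      have := hmax (N + 1) ⟨m, by push_cast; linarith, by push_cast; linarith,
        by push_cast; linarith⟩
      omega
    rcases le_or_gt (m * s - N * u₂) (c + 1) with h6 | h6
    · refine ⟨m, N - m, by linarith, by linarith, ?_, ?_⟩ <;> push_cast <;> linarith
    · refine ⟨m - 1, N - m, ?_, ?_, ?_, ?_⟩ <;> push_cast at hX ⊢ <;> linarith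
  · have h5 : e + T < m * v₁ + (N - m) * v₂ + v₁ := by
      by_contra! h
      have := hmax (N + 1) ⟨m + 1, by push_cast; linarith, by push_cast; linarith,
        by push_cast; linarith⟩
      omega
    refine ⟨m, N - m, by linarith, by linarith, ?_, ?_⟩ <;> push_cast <;> linarith

/-- The rectangle is placed just above the origin, to the right of `(-u₂, v₂)`, to the left of `(u₁,
v₁)` and below their sum. The signs of `m` and `n` decide on which side of it a lattice point lies.
-/
theorem exists_empty_rectangle {u₁ u₂ v₁ v₂ T : ℝ} (hu₁ : 0 < u₁) (hu₂ : 0 < u₂)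
    (hu : 1 < u₁ + u₂) (hu₁' : u₁ < 1) (hv₁ : 0 < v₁) (hv₂ : 0 < v₂) (hT : T < v₁ + v₂) :
    ∃ c e : ℝ, ∀ m n : ℤ, ¬ (c ≤ m * u₁ - n * u₂ ∧ m * u₁ - n * u₂ ≤ c + 1 ∧
      e ≤ m * v₁ + n * v₂ ∧ m * v₁ + n * v₂ ≤ e + T) := by
  -- The left edge `-s` needs `-u₂ < -s` and `1 - s < u₁`; such an `s` exists because `u₁ + u₂ > 1`.
  obtain ⟨s, hs1, hs2⟩ := exists_between (show 1 - u₁ < u₂ by linarith)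
  obtain ⟨t, ht1, ht2⟩ := exists_between hT
  obtain ⟨ε, hε0, hε⟩ := exists_between (show (0 : ℝ) < v₁ + v₂ - T by linarith)
  refine ⟨-s, ε, ?_⟩
  rintro m n ⟨h1, h2, h3, h4⟩
  rcases le_or_gt m 0 with hm | hm <;> rcases le_or_gt n 0 with hn | hn
  · have hm' : (m : ℝ) ≤ 0 := by exact_mod_cast hm
    have hn' : (n : ℝ) ≤ 0 := by exact_mod_cast hn
    nlinarith
  · have hm' : (m : ℝ) ≤ 0 := by exact_mod_cast hm
    have hn' : (1 : ℝ) ≤ n := by exact_mod_cast hn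
    nlinarith
  · have hm' : (1 : ℝ) ≤ m := by exact_mod_cast hm
    have hn' : (n : ℝ) ≤ 0 := by exact_mod_cast hn
    nlinarith
  · have hm' : (1 : ℝ) ≤ m := by exact_mod_cast hm
    have hn' : (1 : ℝ) ≤ n := by exact_mod_cast hn
    nlinarith

/-! ### From the diamond to the rectangle. -/

/-- The unimodular map which sends `R𝔓` to a rectangle of width `1` and height `2R²`. -/
def diamondToRectangle (R : ℝ) (hR : 0 < R) : Matrix.SpecialLinearGroup (Fin 2) ℝ :=
  mkSL ![![1 / (2 * R), -R], ![1 / (2 * R), R]] (by simp [arrayDet]; field_simp; norm_num)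

theorem mul_diamondToRectangle {R : ℝ} (hR : 0 < R) (A : Matrix.SpecialLinearGroup (Fin 2) ℝ)
    (i : Fin 2) : (A * diamondToRectangle R hR) i 0 = (A i 0 + A i 1) / (2 * R) ∧
      (A * diamondToRectangle R hR) i 1 = R * (A i 1 - A i 0) := by
  constructor <;> rw [specialLinearGroup_mul_apply] <;> simp [diamondToRectangle] <;> ring

theorem abs_add_abs_le_iff_rectangle {R : ℝ} (hR : 0 < R) (x y : ℝ) :
    |x| + |y| ≤ R ↔ |(x + y) / (2 * R)| ≤ 1 / 2 ∧ |R * (y - x)| ≤ R ^ 2 := by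
  rw [abs_div, abs_of_pos (by positivity : (0 : ℝ) < 2 * R), abs_mul, abs_of_pos hR,
    div_le_iff₀ (by positivity), pow_two, mul_le_mul_iff_right₀ hR]
  rw [show 1 / 2 * (2 * R) = R by ring]
  constructor
  · intro h
    constructor <;> rw [abs_le] <;> constructor <;>
      linarith [le_abs_self x, le_abs_self y, neg_abs_le x, neg_abs_le y]
  · rintro ⟨h1, h2⟩
    rw [abs_le] at h1 h2
    rcases abs_cases x with ⟨hx, -⟩ | ⟨hx, -⟩ <;> rcases abs_cases y with ⟨hy, -⟩ | ⟨hy, -⟩ <;>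
      rw [hx, hy] <;> linarith

theorem mem_uncovered_iff_rectangle {R : ℝ} (hR : 0 < R)
    (A : Matrix.SpecialLinearGroup (Fin 2) ℝ) :
    A ∈ uncovered R ↔ ∃ c e : ℝ, ∀ m n : ℤ,
      let B := A * diamondToRectangle R hR
      ¬ (c ≤ m * B 0 0 + n * B 1 0 ∧ m * B 0 0 + n * B 1 0 ≤ c + 1 ∧
        e ≤ m * B 0 1 + n * B 1 1 ∧ m * B 0 1 + n * B 1 1 ≤ e + 2 * R ^ 2) := by
  have key : ∀ (x y : ℝ) (m n : ℤ),
      |x - (m * A 0 0 + n * A 1 0)| + |y - (m * A 0 1 + n * A 1 1)| ≤ R ↔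
      let B := A * diamondToRectangle R hR
      ((x + y) / (2 * R) - 1 / 2 ≤ m * B 0 0 + n * B 1 0 ∧
        m * B 0 0 + n * B 1 0 ≤ (x + y) / (2 * R) - 1 / 2 + 1 ∧
        R * (y - x) - R ^ 2 ≤ m * B 0 1 + n * B 1 1 ∧
        m * B 0 1 + n * B 1 1 ≤ R * (y - x) - R ^ 2 + 2 * R ^ 2) := by
    intro x y m n
    simp only [(mul_diamondToRectangle hR A 0).1, (mul_diamondToRectangle hR A 0).2,
      (mul_diamondToRectangle hR A 1).1, (mul_diamondToRectangle hR A 1).2]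
    rw [abs_add_abs_le_iff_rectangle hR, abs_le, abs_le]
    have e1 : (x - (m * A 0 0 + n * A 1 0) + (y - (m * A 0 1 + n * A 1 1))) / (2 * R) =
      (x + y) / (2 * R) - (m * ((A 0 0 + A 0 1) / (2 * R)) + n * ((A 1 0 + A 1 1) / (2 * R))) := by
      ring
    have e2 : R * (y - (m * A 0 1 + n * A 1 1) - (x - (m * A 0 0 + n * A 1 0))) =
      R * (y - x) - (m * (R * (A 0 1 - A 0 0)) + n * (R * (A 1 1 - A 1 0))) := by ring
    rw [e1, e2]
    constructor
    · rintro ⟨⟨h1, h2⟩, h3, h4⟩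
      refine ⟨?_, ?_, ?_, ?_⟩ <;> linarith
    · rintro ⟨h1, h2, h3, h4⟩
      refine ⟨⟨?_, ?_⟩, ?_, ?_⟩ <;> linarith
  constructor
  · rintro ⟨x, y, h⟩
    refine ⟨(x + y) / (2 * R) - 1 / 2, R * (y - x) - R ^ 2, fun m n => ?_⟩
    exact fun hcon => absurd (h m n) (not_lt.2 ((key x y m n).2 hcon))
  · rintro ⟨c, e, h⟩
    refine ⟨R * (c + 1 / 2) - (e + R ^ 2) / (2 * R), R * (c + 1 / 2) + (e + R ^ 2) / (2 * R),
      fun m n => ?_⟩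
    by_contra! hcon
    have h2 := (key _ _ m n).1 hcon
    have e1 : (R * (c + 1 / 2) - (e + R ^ 2) / (2 * R) +
      (R * (c + 1 / 2) + (e + R ^ 2) / (2 * R))) / (2 * R) - 1 / 2 = c := by
      field_simp; ring
    have e2 : R * (R * (c + 1 / 2) + (e + R ^ 2) / (2 * R) -
      (R * (c + 1 / 2) - (e + R ^ 2) / (2 * R))) - R ^ 2 = e := by
      field_simp; ring
    rw [e1, e2] at h2
    exact h m n h2

/-- The part of the strip domain where the largest return time to the strip exceeds `T`. -/
def stripTail (T : ℝ) : Set (Matrix.SpecialLinearGroup (Fin 2) ℝ) :=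
  stripDomain ∩ {A | T < A 0 1 + A 1 1}

theorem measurableSet_stripTail (T : ℝ) : MeasurableSet (stripTail T) :=
  measurableSet_stripDomain.inter
    (isOpen_lt (f := fun _ : Matrix.SpecialLinearGroup (Fin 2) ℝ => T) continuous_const
      (by fun_prop)).measurableSet

theorem mem_uncovered_iff_of_mul_mem_stripDomain {R : ℝ} (hR : 0 < R)
    {A : Matrix.SpecialLinearGroup (Fin 2) ℝ} (hA : A * diamondToRectangle R hR ∈ stripDomain)
    (hne : (A * diamondToRectangle R hR) 0 0 - (A * diamondToRectangle R hR) 1 0 ≠ 1) :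
    A ∈ uncovered R ↔ A * diamondToRectangle R hR ∈ stripTail (2 * R ^ 2) := by
  rw [mem_uncovered_iff_rectangle hR]
  set B := A * diamondToRectangle R hR
  obtain ⟨h1, h2, h3, h4, h5, h6, h7⟩ := id hA
  have hdet := specialLinearGroup_det_eq B
  constructor
  · rintro ⟨c, e, h⟩
    refine ⟨hA, ?_⟩
    change 2 * R ^ 2 < _
    by_contra! hT
    obtain ⟨m, n, g1, g2, g3, g4⟩ := exists_lattice_point_in_rectangle h1 h2 (neg_pos.2 h3)
      (by linarith) h6 h7 (by linarith) hT c e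
    exact h m n ⟨by linarith, by linarith, g3, g4⟩
  · rintro ⟨-, hT⟩
    obtain ⟨c, e, h⟩ := exists_empty_rectangle h1 (neg_pos.2 h3)
      (lt_of_le_of_ne (by linarith) (fun h => hne (by linarith))) h2 h6 h7 hT
    refine ⟨c, e, fun m n hcon => h m n ⟨by linarith [hcon.1], by linarith [hcon.2.1],
      hcon.2.2⟩⟩

/-- The set `uncovered R` is invariant under `SL(2, ℤ)`, so `stripDomain` may be replaced by its
right translate by `Q⁻¹`. There the covering criterion reads off the strip basis of `A * Q`, and
right invariance removes `Q`. -/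
theorem coneMeasure_uncovered_inter_stripDomain {R : ℝ} (hR : 0 < R) :
    coneMeasure (uncovered R ∩ stripDomain) = coneMeasure (stripTail (2 * R ^ 2)) := by
  set Q := diamondToRectangle R hR
  have hfund : IsFundamentalDomain integerSubgroup ((fun A => A * Q) ⁻¹' stripDomain) coneMeasure :=
    isFundamentalDomain_stripDomain.preimage_of_equiv
      (measurePreserving_mul_right coneMeasure Q).quasiMeasurePreserving
      (e := id) Function.bijective_id (fun g A => mul_assoc _ _ _)
  rw [isFundamentalDomain_stripDomain.measure_set_eq hfund (isOpen_uncovered R).measurableSet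
    (preimage_smul_uncovered R), ← measure_preimage_mul_right coneMeasure Q (stripTail (2 * R ^ 2))]
  refine measure_congr (Filter.eventuallyEq_set.2 ?_)
  filter_upwards [(measurePreserving_mul_right coneMeasure Q).quasiMeasurePreserving.ae
    ae_sub_ne_one] with A hA
  constructor
  · rintro ⟨h1, h2⟩
    exact (mem_uncovered_iff_of_mul_mem_stripDomain hR h2 hA).1 h1
  · intro h
    exact ⟨(mem_uncovered_iff_of_mul_mem_stripDomain hR h.1 hA).2 h, h.1⟩

theorem invariantMeasure_not_cover {R : ℝ} (hR : 0 < R) (h0 : coneMeasure stripDomain ≠ 0) :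
    invariantMeasure {L : UnimodularLattice 2 |
      ¬ R • crossPolytope 2 + (L.toSubmodule : Set (Fin 2 → ℝ)) = Set.univ} =
    (coneMeasure stripDomain)⁻¹ * coneMeasure (stripTail (2 * R ^ 2)) := by
  set U : Set (UnimodularLattice 2) := {L : UnimodularLattice 2 |
      ¬ R • crossPolytope 2 + (L.toSubmodule : Set (Fin 2 → ℝ)) = Set.univ}
  have hpre : rowLattice ⁻¹' U = uncovered R :=
    Set.ext fun A => (mem_uncovered_iff hR A).symm
  have hU : IsOpen U := by
    change IsOpen (rowLattice ⁻¹' U)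
    rw [hpre]
    exact isOpen_uncovered R
  have hmeas : Measurable (rowLattice (k := 2)) :=
    (continuous_coinduced_rng (f := rowLattice (k := 2))).measurable
  rw [invariantMeasure, Measure.smul_apply, Measure.map_apply hmeas hU.measurableSet, hpre,
    Measure.restrict_apply (isOpen_uncovered R).measurableSet, smul_eq_mul,
    haar_modularDomain_ratio (isOpen_uncovered R).measurableSet (preimage_smul_uncovered R) h0,
    coneMeasure_uncovered_inter_stripDomain hR]

theorem coveringRadius_le {R : ℝ} (hR : 0 < R) {L : UnimodularLattice 2}
    (h : R • crossPolytope 2 + (L.toSubmodule : Set (Fin 2 → ℝ)) = Set.univ) :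
    coveringRadius (crossPolytope 2) L ≤ R :=
  csInf_le ⟨0, fun _ hs => hs.1.le⟩ ⟨hR, h⟩

/-- A large diamond contains a fundamental parallelogram. Thus the infimum in `coveringRadius` is
over a nonempty set and not the default value of `sInf`. -/
theorem exists_cover (L : UnimodularLattice 2) :
    ∃ r : ℝ, 0 < r ∧ r • crossPolytope 2 + (L.toSubmodule : Set (Fin 2 → ℝ)) = Set.univ := by
  have := L.discrete
  have := L.isZLattice
  let b₀ := Module.Free.chooseBasis ℤ L.toSubmodule
  let b := b₀.ofZLatticeBasis ℝ L.toSubmodule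
  set C : ℝ := ∑ i, ‖b i‖ with hC
  have hC0 : 0 ≤ C := Finset.sum_nonneg fun _ _ => norm_nonneg _
  refine ⟨2 * C + 1, by positivity, Set.eq_univ_of_forall fun z => ?_⟩
  refine ⟨ZSpan.fract b z, ?_, z - ZSpan.fract b z, ?_, add_sub_cancel _ _⟩
  · rw [mem_smul_crossPolytope_iff (by positivity)]
    have h := ZSpan.norm_fract_le b z
    have h0 := (norm_le_pi_norm (ZSpan.fract b z) 0).trans h
    have h1 := (norm_le_pi_norm (ZSpan.fract b z) 1).trans h
    rw [Real.norm_eq_abs] at h0 h1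
    linarith
  · have h : z - ZSpan.fract b z = (ZSpan.floor b z : Fin 2 → ℝ) := by
      rw [ZSpan.fract_apply, sub_sub_cancel]
    rw [h]
    exact (b₀.ofZLatticeBasis_span ℝ).le (ZSpan.floor b z).2

theorem le_coveringRadius {R : ℝ} (hR : 0 < R) {L : UnimodularLattice 2}
    (h : ¬ R • crossPolytope 2 + (L.toSubmodule : Set (Fin 2 → ℝ)) = Set.univ) :
    R ≤ coveringRadius (crossPolytope 2) L := by
  refine le_csInf (exists_cover L) fun s hs => ?_
  by_contra! hlt
  refine h (Set.eq_univ_of_univ_subset ?_)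
  rw [← hs.2]
  refine Set.add_subset_add_right fun z hz => ?_
  rw [mem_smul_crossPolytope_iff hs.1] at hz
  exact (mem_smul_crossPolytope_iff hR z).2 (hz.trans hlt.le)

/-! ### The cone volume in adapted coordinates. -/

theorem lintegral_eq_abs_mul_lintegral_comp_mul {k : ℝ} (hk : k ≠ 0) (f : ℝ → ℝ≥0∞) :
    ∫⁻ x, f x = ENNReal.ofReal |k| * ∫⁻ x, f (k * x) := by
  have h := (measurableEmbedding_mulLeft₀ hk).lintegral_map (μ := volume) f
  rw [Real.map_volume_mul_left hk, lintegral_smul_measure, smul_eq_mul] at h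
  rw [← h, ← mul_assoc, ← ENNReal.ofReal_mul (abs_nonneg k), ← abs_mul, mul_inv_cancel₀ hk,
    abs_one, ENNReal.ofReal_one, one_mul]

theorem lintegral_eq_inv_mul_lintegral_affine {k : ℝ} (hk : k ≠ 0) (c : ℝ) (f : ℝ → ℝ≥0∞) :
    ∫⁻ x, f x = ENNReal.ofReal |k|⁻¹ * ∫⁻ y, f ((y - c) / k) := by
  rw [lintegral_sub_right_eq_self (fun y => f (y / k)) c,
    lintegral_eq_abs_mul_lintegral_comp_mul (inv_ne_zero hk) f, abs_inv]
  simp only [div_eq_inv_mul]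

theorem lintegral_volume_prod {α β : Type*} [MeasureSpace α] [MeasureSpace β]
    [SFinite (volume : Measure β)] {f : α × β → ℝ≥0∞} (hf : Measurable f) :
    ∫⁻ p, f p = ∫⁻ a, ∫⁻ b, f (a, b) :=
  lintegral_prod f hf.aemeasurable

theorem lintegral_array_eq {G : (Fin 2 → Fin 2 → ℝ) → ℝ≥0∞} (hG : Measurable G) :
    ∫⁻ M, G M = ∫⁻ a, ∫⁻ b, ∫⁻ c, ∫⁻ d, G ![![a, b], ![c, d]] := by
  let e : (Fin 2 → Fin 2 → ℝ) ≃ᵐ (ℝ × ℝ) × (ℝ × ℝ) :=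
    MeasurableEquiv.finTwoArrow.trans
      (MeasurableEquiv.prodCongr MeasurableEquiv.finTwoArrow MeasurableEquiv.finTwoArrow)
  have he : MeasurePreserving e :=
    ((volume_preserving_finTwoArrow ℝ).prod (volume_preserving_finTwoArrow ℝ)).comp
      (volume_preserving_finTwoArrow (Fin 2 → ℝ))
  have hm : Measurable fun p => G (e.symm p) := hG.comp e.symm.measurable
  have h1 : ∫⁻ M, G M = ∫⁻ p, G (e.symm p) := by
    rw [← he.lintegral_comp hm]
    simp only [MeasurableEquiv.symm_apply_apply]
  have he2 : ∀ a b c d : ℝ, e.symm ((a, b), (c, d)) = ![![a, b], ![c, d]] := fun a b c d => by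
    rw [MeasurableEquiv.symm_apply_eq]
    rfl
  rw [h1, lintegral_volume_prod hm]
  rw [lintegral_volume_prod (f := fun q : ℝ × ℝ => ∫⁻ r : ℝ × ℝ, G (e.symm (q, r)))
    hm.lintegral_prod_right']
  refine lintegral_congr fun a => lintegral_congr fun b => ?_
  rw [lintegral_volume_prod (f := fun r : ℝ × ℝ => G (e.symm ((a, b), r)))
    (hm.comp measurable_prodMk_left)]
  simp only [he2]

theorem lintegral_rotate_four {F : ℝ → ℝ → ℝ → ℝ → ℝ≥0∞}
    (hF : Measurable fun p : ℝ × ℝ × ℝ × ℝ => F p.1 p.2.1 p.2.2.1 p.2.2.2) :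
    ∫⁻ a, ∫⁻ b, ∫⁻ c, ∫⁻ d, F a b c d = ∫⁻ d, ∫⁻ a, ∫⁻ b, ∫⁻ c, F a b c d := by
  have h1 : ∀ a b, ∫⁻ c, ∫⁻ d, F a b c d = ∫⁻ d, ∫⁻ c, F a b c d := fun a b =>
    lintegral_lintegral_swap (Measurable.aemeasurable (hF.comp (f := fun q : ℝ × ℝ => (a, b, q.1, q.2))
      (by fun_prop)))
  have h2 : ∀ a, ∫⁻ b, ∫⁻ d, ∫⁻ c, F a b c d = ∫⁻ d, ∫⁻ b, ∫⁻ c, F a b c d := fun a =>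
    lintegral_lintegral_swap (Measurable.aemeasurable (Measurable.lintegral_prod_right'
      (f := fun q : (ℝ × ℝ) × ℝ => F a q.1.1 q.2 q.1.2)
      (hF.comp (f := fun q : (ℝ × ℝ) × ℝ => (a, q.1.1, q.2, q.1.2)) (by fun_prop))))
  have h3 : ∫⁻ a, ∫⁻ d, ∫⁻ b, ∫⁻ c, F a b c d = ∫⁻ d, ∫⁻ a, ∫⁻ b, ∫⁻ c, F a b c d := by
    refine lintegral_lintegral_swap (Measurable.aemeasurable ?_)
    have : Measurable fun q : (ℝ × ℝ) × ℝ => ∫⁻ c, F q.1.1 q.2 c q.1.2 :=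
      Measurable.lintegral_prod_right'
        (f := fun q : ((ℝ × ℝ) × ℝ) × ℝ => F q.1.1.1 q.1.2 q.2 q.1.1.2)
        (hF.comp (f := fun q : ((ℝ × ℝ) × ℝ) × ℝ => (q.1.1.1, q.1.2, q.2, q.1.1.2)) (by fun_prop))
    exact this.lintegral_prod_right'
  simp only [h1, h2, h3]

/-- The indicator of the cone over `stripTail T`, as a function of the four entries. -/
def coneIndicator (T a b c d : ℝ) : ℝ≥0∞ :=
  if 0 < a * d - b * c ∧ a * d - b * c < 1 ∧ 0 < a ∧ a < √(a * d - b * c) ∧ c < 0 ∧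
    -√(a * d - b * c) < c ∧ √(a * d - b * c) ≤ a - c ∧ 0 < b ∧ 0 < d ∧
    √(a * d - b * c) * T < b + d then 1 else 0

theorem measurable_coneIndicator (T : ℝ) :
    Measurable fun p : ℝ × ℝ × ℝ × ℝ => coneIndicator T p.1 p.2.1 p.2.2.1 p.2.2.2 := by
  unfold coneIndicator
  refine Measurable.ite ?_ (by fun_prop) (by fun_prop)
  measurability

theorem coneMeasure_stripTail_eq_lintegral (T : ℝ) :
    coneMeasure (stripTail T) = ∫⁻ a, ∫⁻ b, ∫⁻ c, ∫⁻ d, coneIndicator T a b c d := by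
  have hS : MeasurableSet (normalizeDet ⁻¹' stripTail T ∩ detUnit) :=
    (measurable_normalizeDet (measurableSet_stripTail T)).inter measurableSet_detUnit
  classical
  rw [coneMeasure_apply (measurableSet_stripTail T), ← lintegral_indicator_one hS,
    lintegral_array_eq (measurable_one.indicator hS)]
  refine lintegral_congr fun a => lintegral_congr fun b => lintegral_congr fun c =>
    lintegral_congr fun d => ?_
  have hdet : arrayDet ![![a, b], ![c, d]] = a * d - b * c := by simp [arrayDet]
  rw [Set.indicator_apply, coneIndicator, Pi.one_apply]
  refine if_congr ?_ rfl rfl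
  rw [Set.mem_inter_iff, Set.mem_preimage]
  have hunit : ![![a, b], ![c, d]] ∈ detUnit ↔ 0 < a * d - b * c ∧ a * d - b * c < 1 := by
    change 0 < arrayDet _ ∧ arrayDet _ < 1 ↔ _
    rw [hdet]
  rw [hunit]
  by_cases h0 : 0 < a * d - b * c
  swap
  · simp [h0]
  have hs : 0 < √(a * d - b * c) := Real.sqrt_pos.2 h0
  have hn : ∀ i j, normalizeDet ![![a, b], ![c, d]] i j =
      (√(a * d - b * c))⁻¹ * (![![a, b], ![c, d]] : Fin 2 → Fin 2 → ℝ) i j := fun i j => by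
    rw [normalizeDet_apply (by rwa [hdet]), hdet]
  have hmem : normalizeDet ![![a, b], ![c, d]] ∈ stripTail T ↔
      0 < a ∧ a < √(a * d - b * c) ∧ c < 0 ∧ -√(a * d - b * c) < c ∧ √(a * d - b * c) ≤ a - c ∧
      0 < b ∧ 0 < d ∧ √(a * d - b * c) * T < b + d := by
    simp only [stripTail, stripDomain, Set.mem_inter_iff, Set.mem_ofPred_eq, hn,
      Matrix.cons_val_zero, Matrix.cons_val_one]
    set s := √(a * d - b * c)
    rw [← mul_sub, ← mul_add]
    simp only [lt_inv_mul_iff₀ hs, inv_mul_lt_iff₀ hs, le_inv_mul_iff₀ hs, mul_zero, mul_one,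
      mul_neg]
    tauto
  rw [hmem]
  tauto

/-- The part of the strip-domain density where `u₂` exceeds `u₁`. -/
def gapDensity (a u σ : ℝ) : ℝ≥0∞ :=
  if 0 < a ∧ u < 1 ∧ 1 ≤ a + u ∧ a * σ < 1 ∧ 1 < u * σ then ENNReal.ofReal (u - a)⁻¹ else 0

@[fun_prop]
theorem measurable_gapDensity :
    Measurable fun p : ℝ × ℝ × ℝ => gapDensity p.1 p.2.1 p.2.2 := by
  unfold gapDensity
  refine Measurable.ite ?_ (by fun_prop) (by fun_prop)
  measurability

/-- The cone indicator in the coordinates `u₁`, `u₂`, `v₁ + v₂` and the determinant. -/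
def coneDensity (T a u σ D : ℝ) : ℝ≥0∞ :=
  if 0 < D ∧ D < 1 ∧ 0 < a ∧ a < √D ∧ 0 < u ∧ u < √D ∧ √D ≤ a + u ∧
    0 < (D - a * σ) / (u - a) ∧ 0 < σ - (D - a * σ) / (u - a) ∧ √D * T < σ
  then ENNReal.ofReal |u - a|⁻¹ else 0

theorem measurable_coneDensity (T : ℝ) :
    Measurable fun p : ℝ × ℝ × ℝ × ℝ => coneDensity T p.1 p.2.1 p.2.2.1 p.2.2.2 := by
  unfold coneDensity
  refine Measurable.ite ?_ (by fun_prop) (by fun_prop)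
  measurability

theorem lintegral_coneIndicator_eq (T : ℝ) :
    ∫⁻ a, ∫⁻ b, ∫⁻ c, ∫⁻ d, coneIndicator T a b c d =
      ∫⁻ a, ∫⁻ u, ∫⁻ σ, ∫⁻ D, coneDensity T a u σ D := by
  have hm := measurable_coneIndicator T
  refine lintegral_congr fun a => ?_
  have h1 : ∫⁻ b, ∫⁻ c, ∫⁻ d, coneIndicator T a b c d =
      ∫⁻ c, ∫⁻ b, ∫⁻ d, coneIndicator T a b c d :=
    lintegral_lintegral_swap (Measurable.aemeasurable (Measurable.lintegral_prod_right'
      (f := fun q : (ℝ × ℝ) × ℝ => coneIndicator T a q.1.1 q.1.2 q.2)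
      (hm.comp (f := fun q : (ℝ × ℝ) × ℝ => (a, q.1.1, q.1.2, q.2)) (by fun_prop))))
  rw [h1, ← lintegral_neg_eq_self]
  refine lintegral_congr_ae ?_
  filter_upwards [Measure.ae_ne volume a] with u hu
  have hua : u - a ≠ 0 := sub_ne_zero.2 hu
  have h2 : ∀ b, ∫⁻ d, coneIndicator T a b (-u) d = ∫⁻ σ, coneIndicator T a b (-u) (σ + -b) :=
    fun b => (lintegral_add_right_eq_self (fun d => coneIndicator T a b (-u) d) (-b)).symm
  simp only [h2]
  rw [lintegral_lintegral_swap (f := fun b σ => coneIndicator T a b (-u) (σ + -b))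
    (Measurable.aemeasurable (hm.comp (f := fun q : ℝ × ℝ => (a, q.1, -u, q.2 + -q.1)) (by fun_prop)))]
  refine lintegral_congr fun σ => ?_
  -- With `c = -u` and `d = σ - b` the determinant is `D = a * σ + b * (u - a)`, so `b` is traded
  -- for `D` with Jacobian `1 / |u - a|`.
  rw [lintegral_eq_inv_mul_lintegral_affine hua (a * σ), ← lintegral_const_mul' _ _ ENNReal.ofReal_ne_top]
  refine lintegral_congr fun D => ?_
  have hD : a * (σ + -((D - a * σ) / (u - a))) - (D - a * σ) / (u - a) * -u = D := by
    field_simp; ring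
  rw [coneIndicator, coneDensity, hD, mul_ite, mul_one, mul_zero]
  refine if_congr ?_ rfl rfl
  rw [sub_neg_eq_add, add_neg_cancel_comm_assoc, ← sub_eq_add_neg, neg_lt_zero, neg_lt_neg_iff]

/-- Lengths are rescaled by `√D`. The positivity of `v₁` and `v₂` becomes the condition that `1 / σ`
lies strictly between `a` and `u`; the two `gapDensity` terms correspond to the two orders of `a`
and `u`. -/
theorem coneDensity_scale {T a u σ D : ℝ} (hT : 0 ≤ T) (h0 : 0 < D) (h1 : D < 1) :
    coneDensity T (√D * a) (√D * u) (√D * σ) D =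
      ENNReal.ofReal (√D)⁻¹ * (if T < σ then gapDensity a u σ + gapDensity u a σ else 0) := by
  have hs : 0 < √D := Real.sqrt_pos.2 h0
  have hss : √D * √D = D := Real.mul_self_sqrt h0.le
  set s := √D with hsdef
  have hdiv : (D - s * a * (s * σ)) / (s * u - s * a) = s * ((1 - a * σ) / (u - a)) := by
    rcases eq_or_ne u a with rfl | hne
    · simp
    · have : u - a ≠ 0 := sub_ne_zero.2 hne
      rw [← mul_sub]
      field_simp
      rw [← hss]; ring
  have habs : ENNReal.ofReal |s * u - s * a|⁻¹ = ENNReal.ofReal s⁻¹ * ENNReal.ofReal |u - a|⁻¹ := by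
    rw [← mul_sub, abs_mul, abs_of_pos hs, mul_inv, ENNReal.ofReal_mul (by positivity)]
  rw [coneDensity, ← hsdef, hdiv, habs, ← mul_sub s σ, ← mul_add s a u]
  simp only [h0, h1, true_and, mul_pos_iff_of_pos_left hs, mul_lt_iff_lt_one_right hs,
    le_mul_iff_one_le_right hs, mul_lt_mul_iff_right₀ hs]
  by_cases hTσ : T < σ
  swap
  · simp [hTσ]
  have hσ : 0 < σ := hT.trans_lt hTσ
  simp only [hTσ, and_true, if_true, gapDensity]
  rcases lt_trichotomy u a with h | rfl | h
  · have hneg : u - a < 0 := sub_neg.2 h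
    have e1 : 0 < (1 - a * σ) / (u - a) ↔ 1 < a * σ := by
      rw [← neg_div_neg_eq, neg_sub, neg_sub, div_pos_iff_of_pos_right (sub_pos.2 h), sub_pos]
    have e2 : 0 < σ - (1 - a * σ) / (u - a) ↔ u * σ < 1 := by
      have : σ - (1 - a * σ) / (u - a) = (1 - u * σ) / (a - u) := by
        have h2 : u - a ≠ 0 := hneg.ne
        have h3 : a - u ≠ 0 := by rw [← neg_sub]; exact neg_ne_zero.2 h2
        field_simp; ring
      rw [this, div_pos_iff_of_pos_right (sub_pos.2 h), sub_pos]
    have e3 : ¬ (a * σ < 1 ∧ 1 < u * σ) := by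
      rintro ⟨h2, h3⟩
      have := mul_lt_mul_of_pos_right h hσ
      linarith
    simp only [e1, e2]
    rw [if_neg (c := 0 < a ∧ u < 1 ∧ _) (by tauto), zero_add, abs_of_neg hneg, neg_sub, mul_ite,
      mul_zero]
    refine if_congr ⟨?_, ?_⟩ rfl rfl
    · rintro ⟨g1, g2, g3, g4, g5, g6, g7⟩
      exact ⟨g3, g2, by linarith, g7, g6⟩
    · rintro ⟨g1, g2, g3, g4, g5⟩
      exact ⟨by linarith, g2, g1, by linarith, by linarith, g5, g4⟩
  · simp
  · have hpos : 0 < u - a := sub_pos.2 h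
    have e1 : 0 < (1 - a * σ) / (u - a) ↔ a * σ < 1 := by
      rw [div_pos_iff_of_pos_right hpos, sub_pos]
    have e2 : 0 < σ - (1 - a * σ) / (u - a) ↔ 1 < u * σ := by
      have : σ - (1 - a * σ) / (u - a) = (u * σ - 1) / (u - a) := by
        have h2 : u - a ≠ 0 := hpos.ne'
        field_simp; ring
      rw [this, div_pos_iff_of_pos_right hpos, sub_pos]
    have e3 : ¬ (u * σ < 1 ∧ 1 < a * σ) := by
      rintro ⟨h2, h3⟩
      have := mul_lt_mul_of_pos_right h hσ
      linarith
    simp only [e1, e2]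
    rw [if_neg (c := 0 < u ∧ a < 1 ∧ _) (by tauto), add_zero, abs_of_pos hpos, mul_ite, mul_zero]
    refine if_congr ⟨?_, ?_⟩ rfl rfl
    · rintro ⟨g1, g2, g3, g4, g5, g6, g7⟩
      exact ⟨g1, g4, g5, g6, g7⟩
    · rintro ⟨g1, g2, g3, g4, g5⟩
      exact ⟨g1, by linarith, by linarith, g2, g3, g4, g5⟩

theorem lintegral_ofReal_Ioo_zero_one :
    ∫⁻ D, (if 0 < D ∧ D < 1 then ENNReal.ofReal D else 0) = 2⁻¹ := by
  have h1 : ∀ D : ℝ, (if 0 < D ∧ D < 1 then ENNReal.ofReal D else 0) =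
      (Set.Ioo (0 : ℝ) 1).indicator (fun D => ENNReal.ofReal D) D := fun D => by
    classical
    rw [Set.indicator_apply]; rfl
  simp only [h1]
  rw [lintegral_indicator measurableSet_Ioo, ← ofReal_integral_eq_lintegral_ofReal]
  · rw [← integral_Ioc_eq_integral_Ioo, ← intervalIntegral.integral_of_le zero_le_one, integral_id]
    norm_num [ENNReal.ofReal_div_of_pos]
  · exact (continuous_id.integrableOn_Icc (a := (0 : ℝ)) (b := 1)).mono_set Set.Ioo_subset_Icc_self
  · exact (ae_restrict_iff' measurableSet_Ioo).2 (Filter.Eventually.of_forall fun x hx => hx.1.le)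

/-- Three rescaled variables contribute `D ^ (3/2)` and the density `D ^ (-1/2)`, leaving `∫ D dD =
1/2` over `(0, 1)`. This cancels the factor `2` from the symmetry between `a` and `u`. -/
theorem coneMeasure_stripTail {T : ℝ} (hT : 0 ≤ T) :
    coneMeasure (stripTail T) = ∫⁻ a, ∫⁻ u, ∫⁻ σ, if T < σ then gapDensity a u σ else 0 := by
  have hw : Measurable fun p : ℝ × ℝ × ℝ => if T < p.2.2 then gapDensity p.1 p.2.1 p.2.2 else 0 :=
    Measurable.ite (measurableSet_lt measurable_const (by fun_prop)) (by fun_prop) measurable_const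
  set K := ∫⁻ a, ∫⁻ u, ∫⁻ σ, if T < σ then gapDensity a u σ else 0 with hK
  have hsum : ∫⁻ a, ∫⁻ u, ∫⁻ σ, (if T < σ then gapDensity a u σ + gapDensity u a σ else 0) =
      2 * K := by
    have h1 : ∀ a u σ : ℝ, (if T < σ then gapDensity a u σ + gapDensity u a σ else 0) =
        (if T < σ then gapDensity a u σ else 0) + (if T < σ then gapDensity u a σ else 0) := by
      intro a u σ; split_ifs <;> simp
    have h2 : ∀ a u : ℝ, ∫⁻ σ, (if T < σ then gapDensity a u σ + gapDensity u a σ else 0) =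
        (∫⁻ σ, if T < σ then gapDensity a u σ else 0) +
          ∫⁻ σ, if T < σ then gapDensity u a σ else 0 := fun a u => by
      simp only [h1]
      exact lintegral_add_left (hw.comp (f := fun σ : ℝ => (a, u, σ)) (by fun_prop)) _
    have hi : Measurable fun q : ℝ × ℝ => ∫⁻ σ, if T < σ then gapDensity q.1 q.2 σ else 0 :=
      Measurable.lintegral_prod_right'
        (f := fun q : (ℝ × ℝ) × ℝ => if T < q.2 then gapDensity q.1.1 q.1.2 q.2 else 0)
        (hw.comp (f := fun q : (ℝ × ℝ) × ℝ => (q.1.1, q.1.2, q.2)) (by fun_prop))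
    simp only [h2]
    have h3 : ∀ a : ℝ, ∫⁻ u, ((∫⁻ σ, if T < σ then gapDensity a u σ else 0) +
          ∫⁻ σ, if T < σ then gapDensity u a σ else 0) =
        (∫⁻ u, ∫⁻ σ, if T < σ then gapDensity a u σ else 0) +
          ∫⁻ u, ∫⁻ σ, if T < σ then gapDensity u a σ else 0 := fun a =>
      lintegral_add_left (hi.comp (f := fun u : ℝ => (a, u)) (by fun_prop)) _
    simp only [h3]
    rw [lintegral_add_left hi.lintegral_prod_right', two_mul]
    congr 1
    exact lintegral_lintegral_swap (μ := volume) (ν := volume)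
      (f := fun a u => ∫⁻ σ, if T < σ then gapDensity u a σ else 0)
      (hi.comp measurable_swap).aemeasurable
  have hD : ∀ D : ℝ, ∫⁻ a, ∫⁻ u, ∫⁻ σ, coneDensity T a u σ D =
      (if 0 < D ∧ D < 1 then ENNReal.ofReal D else 0) * (2 * K) := by
    intro D
    by_cases h : 0 < D ∧ D < 1
    · obtain ⟨h0, h1⟩ := h
      have hs : 0 < √D := Real.sqrt_pos.2 h0
      rw [if_pos ⟨h0, h1⟩, ← hsum, lintegral_eq_abs_mul_lintegral_comp_mul hs.ne']
      have e1 : ∀ a : ℝ, ∫⁻ u, ∫⁻ σ, coneDensity T (√D * a) u σ D = ENNReal.ofReal √D *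
          ∫⁻ u, ∫⁻ σ, coneDensity T (√D * a) (√D * u) σ D := fun a => by
        rw [lintegral_eq_abs_mul_lintegral_comp_mul hs.ne', abs_of_pos hs]
      have e2 : ∀ a u : ℝ, ∫⁻ σ, coneDensity T (√D * a) (√D * u) σ D =
          ∫⁻ σ, (if T < σ then gapDensity a u σ + gapDensity u a σ else 0) := fun a u => by
        rw [lintegral_eq_abs_mul_lintegral_comp_mul hs.ne', abs_of_pos hs]
        simp only [coneDensity_scale hT h0 h1]
        rw [lintegral_const_mul' _ _ ENNReal.ofReal_ne_top, ← mul_assoc,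
          ← ENNReal.ofReal_mul hs.le, mul_inv_cancel₀ hs.ne', ENNReal.ofReal_one, one_mul]
      simp only [e1, e2]
      rw [lintegral_const_mul' _ _ ENNReal.ofReal_ne_top, ← mul_assoc, abs_of_pos hs,
        ← ENNReal.ofReal_mul hs.le, Real.mul_self_sqrt h0.le]
    · have : ∀ a u σ, coneDensity T a u σ D = 0 := fun a u σ => if_neg (by tauto)
      simp [this, h]
  have hK2 : (∫⁻ D, (if 0 < D ∧ D < 1 then ENNReal.ofReal D else 0) * (2 * K)) = K := by
    rw [lintegral_mul_const _ (Measurable.ite (by measurability) (by fun_prop) (by fun_prop)),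
      lintegral_ofReal_Ioo_zero_one, ← mul_assoc,
      ENNReal.inv_mul_cancel two_ne_zero ENNReal.ofNat_ne_top, one_mul]
  rw [coneMeasure_stripTail_eq_lintegral, lintegral_coneIndicator_eq,
    lintegral_rotate_four (measurable_coneDensity T)]
  simp only [hD]
  exact hK2

theorem stripTail_zero : stripTail 0 = stripDomain :=
  Set.inter_eq_left.2 fun _ hA => add_pos hA.2.2.2.2.2.1 hA.2.2.2.2.2.2

/-! ### The total mass. -/

/-- The variable `σ` runs through `(1/u, 1/a)`, of length `(u - a) / (a * u)`, which cancels the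
density `1 / (u - a)`. -/
theorem lintegral_gapDensity_height (a u : ℝ) :
    ∫⁻ σ, (if (0 : ℝ) < σ then gapDensity a u σ else 0) =
      if 0 < a ∧ u < 1 ∧ 1 ≤ a + u ∧ a < u then ENNReal.ofReal (a * u)⁻¹ else 0 := by
  classical
  split_ifs with h
  · obtain ⟨h1, h2, h3, h4⟩ := h
    have hu : 0 < u := h1.trans h4
    have e1 : ∀ σ : ℝ, (if (0 : ℝ) < σ then gapDensity a u σ else 0) =
        (Set.Ioo u⁻¹ a⁻¹).indicator (fun _ => ENNReal.ofReal (u - a)⁻¹) σ := by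
      intro σ
      rw [Set.indicator_apply, gapDensity, ← ite_and]
      refine if_congr ?_ rfl rfl
      rw [Set.mem_Ioo, inv_lt_iff_one_lt_mul₀' hu, ← one_div, lt_div_iff₀' h1]
      constructor
      · rintro ⟨-, -, -, -, g1, g2⟩
        exact ⟨g2, g1⟩
      · rintro ⟨g1, g2⟩
        exact ⟨pos_of_mul_pos_right (one_pos.trans g1) hu.le, h1, h2, h3, g2, g1⟩
    simp only [e1]
    rw [lintegral_indicator_const measurableSet_Ioo, Real.volume_Ioo,
      ← ENNReal.ofReal_mul (by rw [inv_nonneg]; linarith)]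
    congr 1
    have : u - a ≠ 0 := (sub_pos.2 h4).ne'
    field_simp
  · have e1 : ∀ σ : ℝ, (if (0 : ℝ) < σ then gapDensity a u σ else 0) = 0 := by
      intro σ
      rw [gapDensity, ← ite_and, if_neg]
      rintro ⟨h0, h1, h2, h3, h4, h5⟩
      refine h ⟨h1, h2, h3, ?_⟩
      by_contra! h6
      have := mul_le_mul_of_nonneg_right h6 h0.le
      linarith
    simp only [e1, lintegral_zero]

/-- Integrating the power series of `-log (1 - a) / a` term by term gives `∑ 1 / (n + 1)² = ζ(2)`.
-/
theorem lintegral_neg_log_one_sub_div :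
    ∫⁻ a in Set.Ioo (0 : ℝ) 1, ENNReal.ofReal (a⁻¹ * -Real.log (1 - a)) =
      ENNReal.ofReal (Real.pi ^ 2 / 6) := by
  have h1 : ∫⁻ a in Set.Ioo (0 : ℝ) 1, ENNReal.ofReal (a⁻¹ * -Real.log (1 - a)) =
      ∫⁻ a in Set.Ioo (0 : ℝ) 1, ∑' n : ℕ, ENNReal.ofReal (a ^ n / (n + 1)) := by
    refine setLIntegral_congr_fun measurableSet_Ioo fun a ha => ?_
    have h := (Real.hasSum_pow_div_log_of_abs_lt_one
      (by rw [abs_of_pos ha.1]; exact ha.2 : |a| < 1)).mul_left a⁻¹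
    have h2 : ∀ n : ℕ, a⁻¹ * (a ^ (n + 1) / (n + 1)) = a ^ n / (n + 1) := fun n => by
      have := ha.1.ne'
      rw [pow_succ]; field_simp
    simp only [h2] at h
    rw [← h.tsum_eq, ENNReal.ofReal_tsum_of_nonneg _ h.summable]
    intro n
    have := ha.1.le
    positivity
  have h2 : ∀ n : ℕ, ∫⁻ a in Set.Ioo (0 : ℝ) 1, ENNReal.ofReal (a ^ n / (n + 1)) =
      ENNReal.ofReal (1 / ((n + 1 : ℕ) : ℝ) ^ 2) := by
    intro n
    rw [← ofReal_integral_eq_lintegral_ofReal]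
    · rw [← integral_Ioc_eq_integral_Ioo, ← intervalIntegral.integral_of_le zero_le_one,
        intervalIntegral.integral_div, integral_pow]
      congr 1
      push_cast
      simp
      field_simp
    · exact ((by fun_prop : Continuous fun a : ℝ => a ^ n / (n + 1)).integrableOn_Icc
        (a := (0 : ℝ)) (b := 1)).mono_set Set.Ioo_subset_Icc_self
    · refine (ae_restrict_iff' measurableSet_Ioo).2 (Filter.Eventually.of_forall fun x hx => ?_)
      have := hx.1.le
      change 0 ≤ x ^ n / (n + 1)
      positivity
  rw [h1, lintegral_tsum fun n => by fun_prop]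
  simp only [h2]
  have h3 := hasSum_zeta_two
  have h4 : HasSum (fun n : ℕ => 1 / ((n + 1 : ℕ) : ℝ) ^ 2) (Real.pi ^ 2 / 6) := by
    have := (hasSum_nat_add_iff' (f := fun n : ℕ => 1 / (n : ℝ) ^ 2) 1).2 h3
    simpa using this
  rw [← ENNReal.ofReal_tsum_of_nonneg (fun n => by positivity) h4.summable, h4.tsum_eq]

/-- Symmetrising in `a` and `u` removes the constraint `a < u`. Twice the mass is then the integral
of `1 / (a * u)` over `0 < a < 1`, `1 - a ≤ u < 1`. -/
theorem coneMeasure_stripDomain :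
    coneMeasure stripDomain = ENNReal.ofReal (Real.pi ^ 2 / 12) := by
  classical
  set q : ℝ → ℝ → ℝ≥0∞ := fun a u =>
    if 0 < a ∧ u < 1 ∧ 1 ≤ a + u ∧ a < u then ENNReal.ofReal (a * u)⁻¹ else 0 with hq
  have hqm : Measurable fun p : ℝ × ℝ => q p.1 p.2 := by
    rw [hq]
    refine Measurable.ite ?_ (by fun_prop) (by fun_prop)
    measurability
  have h1 : coneMeasure stripDomain = ∫⁻ a, ∫⁻ u, q a u := by
    rw [← stripTail_zero, coneMeasure_stripTail le_rfl]
    simp only [lintegral_gapDensity_height, hq]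
  have h2 : ∫⁻ a, ∫⁻ u, q u a = ∫⁻ a, ∫⁻ u, q a u :=
    lintegral_lintegral_swap (μ := volume) (ν := volume) (f := fun a u => q u a)
      (hqm.comp measurable_swap).aemeasurable
  have h3 : 2 * coneMeasure stripDomain = ∫⁻ a, ∫⁻ u, (q a u + q u a) := by
    have e : ∀ a, ∫⁻ u, (q a u + q u a) = (∫⁻ u, q a u) + ∫⁻ u, q u a := fun a =>
      lintegral_add_left (hqm.comp measurable_prodMk_left) _
    simp only [e]
    rw [lintegral_add_left hqm.lintegral_prod_right', h2, ← h1, two_mul]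
  have h4 : ∀ a, ∫⁻ u, (q a u + q u a) = (Set.Ioo (0 : ℝ) 1).indicator
      (fun a => ENNReal.ofReal (a⁻¹ * -Real.log (1 - a))) a := by
    intro a
    rw [Set.indicator_apply]
    split_ifs with ha
    · have e1 : ∀ᵐ u : ℝ, q a u + q u a =
          (Set.Ico (1 - a) 1).indicator (fun u => ENNReal.ofReal (a⁻¹ * u⁻¹)) u := by
        filter_upwards [Measure.ae_ne volume a] with u hu
        rw [Set.indicator_apply, hq]
        simp only
        rcases lt_or_gt_of_ne hu with h | h
        · rw [if_neg (by rintro ⟨-, -, -, h'⟩; linarith), zero_add, mul_comm u a, mul_inv]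
          refine if_congr ⟨?_, ?_⟩ rfl rfl
          · rintro ⟨g1, g2, g3, g4⟩
            exact ⟨by linarith, by linarith⟩
          · rintro ⟨g1, g2⟩
            exact ⟨by linarith [ha.2], ha.2, by linarith, h⟩
        · rw [if_neg (c := 0 < u ∧ a < 1 ∧ _) (by rintro ⟨-, -, -, h'⟩; linarith), add_zero, mul_inv]
          refine if_congr ⟨?_, ?_⟩ rfl rfl
          · rintro ⟨g1, g2, g3, g4⟩
            exact ⟨by linarith, by linarith⟩
          · rintro ⟨g1, g2⟩
            exact ⟨ha.1, g2, by linarith, h⟩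
      have hpos : 0 < 1 - a := by linarith [ha.2]
      have hle : 1 - a ≤ 1 := by linarith [ha.1]
      rw [lintegral_congr_ae e1, lintegral_indicator measurableSet_Ico,
        ← ofReal_integral_eq_lintegral_ofReal]
      · rw [integral_Ico_eq_integral_Ioo, ← integral_Ioc_eq_integral_Ioo,
          ← intervalIntegral.integral_of_le hle, intervalIntegral.integral_const_mul,
          integral_inv_of_pos hpos one_pos, one_div, Real.log_inv]
      · refine (ContinuousOn.integrableOn_Icc (a := 1 - a) (b := 1) ?_).mono_set
          Set.Ico_subset_Icc_self
        exact continuousOn_const.mul (continuousOn_id.inv₀ fun x hx => (hpos.trans_le hx.1).ne')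
      · refine (ae_restrict_iff' measurableSet_Ico).2 (Filter.Eventually.of_forall fun x hx => ?_)
        have := ha.1
        have := hpos.trans_le hx.1
        change 0 ≤ a⁻¹ * x⁻¹
        positivity
    · have e1 : ∀ u : ℝ, q a u + q u a = 0 := by
        intro u
        rw [hq]
        simp only
        rw [if_neg, if_neg, add_zero]
        · rintro ⟨g1, g2, g3, g4⟩
          exact ha ⟨by linarith, g2⟩
        · rintro ⟨g1, g2, g3, g4⟩
          exact ha ⟨g1, by linarith⟩
      simp only [e1, lintegral_zero]
  simp only [h4] at h3
  rw [lintegral_indicator measurableSet_Ioo, lintegral_neg_log_one_sub_div] at h3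
  have h5 : (2 : ℝ≥0∞) * ENNReal.ofReal (Real.pi ^ 2 / 12) = ENNReal.ofReal (Real.pi ^ 2 / 6) := by
    rw [← ENNReal.ofReal_ofNat, ← ENNReal.ofReal_mul (by norm_num)]
    congr 1; ring
  rw [← h5] at h3
  exact (ENNReal.mul_right_inj two_ne_zero ENNReal.ofNat_ne_top).1 h3

/-! ### The density of the largest return time. -/

/-- The density of the largest return time `σ` to the strip, as a function of `x = 1 / σ`. -/
def inverseGapDensity (x : ℝ) : ℝ :=
  Real.negMulLog (1 - x) + Real.negMulLog (2 * x - 1) / 2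

theorem continuous_inverseGapDensity : Continuous inverseGapDensity := by
  unfold inverseGapDensity
  exact (Real.continuous_negMulLog.comp (by fun_prop)).add
    ((Real.continuous_negMulLog.comp (by fun_prop)).div_const 2)

theorem intervalIntegrable_log_two_mul_sub_one (m : ℝ) :
    IntervalIntegrable (fun u => Real.log (2 * u - 1)) volume m 1 := by
  have h := (intervalIntegral.intervalIntegrable_log' (a := 2 * m - 1) (b := 2 * 1 - 1))
  have h2 := (h.comp_sub_right 1).comp_mul_left (c := 2)
  convert h2 using 1 <;> ring

theorem intervalIntegrable_log_sub (x m : ℝ) :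
    IntervalIntegrable (fun u => Real.log (u - x)) volume m 1 := by
  have h := (intervalIntegral.intervalIntegrable_log' (a := m - x) (b := 1 - x)).comp_sub_right x
  simpa using h

theorem intervalIntegrable_log_sub_log (x m : ℝ) :
    IntervalIntegrable (fun u => Real.log (2 * u - 1) - Real.log (u - x)) volume m 1 :=
  (intervalIntegrable_log_two_mul_sub_one m).sub (intervalIntegrable_log_sub x m)

/-- The lower limit that occurs is `max x (1 - x)`. Both choices give the same value because `log`
means `log |·|`, so the antiderivative `y log y - y` is odd and the boundary terms at `m = 1 - x`
recombine to those at `m = x`. -/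
theorem integral_log_sub_log {x m : ℝ} (hm : m = x ∨ m = 1 - x) :
    ∫ u in m..1, (Real.log (2 * u - 1) - Real.log (u - x)) = inverseGapDensity x := by
  rw [intervalIntegral.integral_sub (intervalIntegrable_log_two_mul_sub_one m)
      (intervalIntegrable_log_sub x m),
    intervalIntegral.integral_comp_mul_sub (fun y => Real.log y) two_ne_zero,
    intervalIntegral.integral_comp_sub_right (fun y => Real.log y), integral_log, integral_log]
  simp only [inverseGapDensity, Real.negMulLog, smul_eq_mul]
  rcases hm with rfl | rfl
  · norm_num
    ring
  · rw [show 2 * (1 - x) - 1 = -(2 * x - 1) by ring, show 1 - x - x = -(2 * x - 1) by ring,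
      Real.log_neg_eq_log]
    norm_num
    ring

/-- At fixed `u` and `σ`, the variable `a` runs through `[1 - u, 1/σ)`. This interval is nonempty,
with `u` beyond it, exactly when `u` exceeds `1/σ` and `1 - 1/σ`. -/
theorem lintegral_gapDensity_width {σ : ℝ} (hσ : 1 < σ) (u : ℝ) :
    ∫⁻ a, gapDensity a u σ = (Set.Ioo (max σ⁻¹ (1 - σ⁻¹)) 1).indicator
      (fun u => ENNReal.ofReal (Real.log (2 * u - 1) - Real.log (u - σ⁻¹))) u := by
  classical
  have hσ0 : 0 < σ := one_pos.trans hσ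
  have hlt : ∀ a : ℝ, a * σ < 1 ↔ a < σ⁻¹ := fun a => by
    rw [← one_div, lt_div_iff₀ hσ0]
  have hgt : 1 < u * σ ↔ σ⁻¹ < u := (inv_lt_iff_one_lt_mul₀ hσ0).symm
  rw [Set.indicator_apply]
  split_ifs with hu
  · obtain ⟨hm, hu1⟩ := hu
    have hx : σ⁻¹ < u := (le_max_left _ _).trans_lt hm
    have hx' : 1 - σ⁻¹ < u := (le_max_right _ _).trans_lt hm
    have e1 : ∀ a : ℝ, gapDensity a u σ =
        (Set.Ico (1 - u) σ⁻¹).indicator (fun a => ENNReal.ofReal (u - a)⁻¹) a := by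
      intro a
      rw [Set.indicator_apply, gapDensity]
      simp only [hlt, hgt]
      refine if_congr ⟨?_, ?_⟩ rfl rfl
      · rintro ⟨g1, g2, g3, g4, g5⟩
        exact ⟨by linarith, g4⟩
      · rintro ⟨g1, g2⟩
        exact ⟨by linarith, hu1, by linarith, g2, hx⟩
    have hle : 1 - u ≤ σ⁻¹ := by linarith
    simp only [e1]
    rw [lintegral_indicator measurableSet_Ico, ← ofReal_integral_eq_lintegral_ofReal]
    · rw [integral_Ico_eq_integral_Ioo, ← integral_Ioc_eq_integral_Ioo,
        ← intervalIntegral.integral_of_le hle,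
        intervalIntegral.integral_comp_sub_left (fun y => y⁻¹),
        integral_inv_of_pos (by linarith) (by linarith),
        Real.log_div (by linarith) (by linarith)]
      congr 3
      ring
    · refine (ContinuousOn.integrableOn_Icc (a := 1 - u) (b := σ⁻¹) ?_).mono_set
        Set.Ico_subset_Icc_self
      exact (continuousOn_const.sub continuousOn_id).inv₀ fun x hx2 =>
        (sub_pos.2 (hx2.2.trans_lt hx)).ne'
    · refine (ae_restrict_iff' measurableSet_Ico).2 (Filter.Eventually.of_forall fun x hx2 => ?_)
      exact inv_nonneg.2 (sub_nonneg.2 (hx2.2.trans hx).le)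
  · have e1 : ∀ a : ℝ, gapDensity a u σ = 0 := by
      intro a
      rw [gapDensity, if_neg]
      simp only [hlt, hgt]
      rintro ⟨g1, g2, g3, g4, g5⟩
      exact hu ⟨max_lt g5 (by linarith), g2⟩
    simp only [e1, lintegral_zero]

/-- The density of the largest return time to the strip. -/
def gapTimeDensity (σ : ℝ) : ℝ := if σ ≤ 1 then 0 else inverseGapDensity σ⁻¹

/-- `inverseGapDensity` vanishes at `1`, so the two branches agree at `σ = 1`. -/
theorem continuous_gapTimeDensity : Continuous gapTimeDensity := by
  have h : gapTimeDensity = fun σ => inverseGapDensity (max σ 1)⁻¹ := by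
    funext σ
    rw [gapTimeDensity]
    split_ifs with hσ
    · rw [max_eq_right hσ]; norm_num [inverseGapDensity]
    · rw [max_eq_left (not_le.1 hσ).le]
  rw [h]
  exact continuous_inverseGapDensity.comp ((continuous_id.max continuous_const).inv₀
    fun x => (one_pos.trans_le (le_max_right x 1)).ne')

theorem log_sub_log_nonneg {x u : ℝ} (hx : x < u) (hx' : 1 - x ≤ u) :
    0 ≤ Real.log (2 * u - 1) - Real.log (u - x) :=
  sub_nonneg.2 (Real.log_le_log (by linarith) (by linarith))

theorem gapTimeDensity_nonneg (σ : ℝ) : 0 ≤ gapTimeDensity σ := by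
  rw [gapTimeDensity]
  split_ifs with h
  · exact le_rfl
  · have h1 : 1 < σ := not_le.1 h
    have h0 : σ⁻¹ < 1 := inv_lt_one_of_one_lt₀ h1
    have h0' : 0 < σ⁻¹ := inv_pos.2 (one_pos.trans h1)
    rw [← integral_log_sub_log (x := σ⁻¹) (m := max σ⁻¹ (1 - σ⁻¹)) (max_choice _ _),
      intervalIntegral.integral_of_le (max_le h0.le (by linarith))]
    refine setIntegral_nonneg measurableSet_Ioc fun u hu => ?_
    exact log_sub_log_nonneg ((le_max_left _ _).trans_lt hu.1)
      ((le_max_right _ _).trans hu.1.le)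

theorem lintegral_lintegral_gapDensity {σ : ℝ} (hσ : 0 < σ) :
    ∫⁻ u, ∫⁻ a, gapDensity a u σ = ENNReal.ofReal (gapTimeDensity σ) := by
  rw [gapTimeDensity]
  split_ifs with h
  · have e1 : ∀ u a : ℝ, gapDensity a u σ = 0 := by
      intro u a
      rw [gapDensity, if_neg]
      rintro ⟨g1, g2, g3, g4, g5⟩
      nlinarith
    simp [e1]
  · have h1 : 1 < σ := not_le.1 h
    have h0 : σ⁻¹ < 1 := inv_lt_one_of_one_lt₀ h1
    have h0' : 0 < σ⁻¹ := inv_pos.2 hσ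
    have hm : max σ⁻¹ (1 - σ⁻¹) ≤ 1 := max_le h0.le (by linarith)
    simp only [lintegral_gapDensity_width h1]
    rw [lintegral_indicator measurableSet_Ioo, ← ofReal_integral_eq_lintegral_ofReal]
    · rw [← integral_Ioc_eq_integral_Ioo, ← intervalIntegral.integral_of_le hm,
        integral_log_sub_log (max_choice _ _)]
    · rw [← IntegrableOn, ← integrableOn_Ioc_iff_integrableOn_Ioo,
        ← intervalIntegrable_iff_integrableOn_Ioc_of_le hm]
      exact intervalIntegrable_log_sub_log _ _
    · refine (ae_restrict_iff' measurableSet_Ioo).2 (Filter.Eventually.of_forall fun u hu => ?_)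
      exact log_sub_log_nonneg ((le_max_left _ _).trans_lt hu.1)
        ((le_max_right _ _).trans hu.1.le)

theorem coneMeasure_stripTail_eq_setLIntegral {T : ℝ} (hT : 0 ≤ T) :
    coneMeasure (stripTail T) = ∫⁻ σ in Set.Ioi T, ENNReal.ofReal (gapTimeDensity σ) := by
  classical
  have hw : Measurable fun p : ℝ × ℝ × ℝ => if T < p.2.2 then gapDensity p.1 p.2.1 p.2.2 else 0 :=
    Measurable.ite (measurableSet_lt measurable_const (by fun_prop)) (by fun_prop) measurable_const
  rw [coneMeasure_stripTail hT]
  have h1 : ∫⁻ a, ∫⁻ u, ∫⁻ σ, (if T < σ then gapDensity a u σ else 0) =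
      ∫⁻ u, ∫⁻ a, ∫⁻ σ, (if T < σ then gapDensity a u σ else 0) :=
    lintegral_lintegral_swap (Measurable.aemeasurable (Measurable.lintegral_prod_right'
      (f := fun q : (ℝ × ℝ) × ℝ => if T < q.2 then gapDensity q.1.1 q.1.2 q.2 else 0)
      (hw.comp (f := fun q : (ℝ × ℝ) × ℝ => (q.1.1, q.1.2, q.2)) (by fun_prop))))
  have h2 : ∀ u : ℝ, ∫⁻ a, ∫⁻ σ, (if T < σ then gapDensity a u σ else 0) =
      ∫⁻ σ, ∫⁻ a, (if T < σ then gapDensity a u σ else 0) := fun u =>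
    lintegral_lintegral_swap (Measurable.aemeasurable
      (hw.comp (f := fun q : ℝ × ℝ => (q.1, u, q.2)) (by fun_prop)))
  have h3 : ∫⁻ u, ∫⁻ σ, ∫⁻ a, (if T < σ then gapDensity a u σ else 0) =
      ∫⁻ σ, ∫⁻ u, ∫⁻ a, (if T < σ then gapDensity a u σ else 0) :=
    lintegral_lintegral_swap (Measurable.aemeasurable (Measurable.lintegral_prod_right'
      (f := fun q : (ℝ × ℝ) × ℝ => if T < q.1.2 then gapDensity q.2 q.1.1 q.1.2 else 0)
      (hw.comp (f := fun q : (ℝ × ℝ) × ℝ => (q.2, q.1.1, q.1.2)) (by fun_prop))))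
  simp only [h1, h2, h3]
  rw [← lintegral_indicator measurableSet_Ioi]
  refine lintegral_congr fun σ => ?_
  rw [Set.indicator_apply]
  by_cases h : T < σ
  · simp only [h, if_true, Set.mem_Ioi]
    exact lintegral_lintegral_gapDensity (hT.trans_lt h)
  · simp [h]

/-- Writing the tail as total mass minus an integral over `[0, T]` makes it differentiable in `T` by
the fundamental theorem of calculus. -/
theorem coneMeasure_stripTail_toReal {T : ℝ} (hT : 0 ≤ T) :
    (coneMeasure (stripTail T)).toReal = Real.pi ^ 2 / 12 - ∫ σ in (0 : ℝ)..T, gapTimeDensity σ := by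
  have h0 := coneMeasure_stripTail_eq_setLIntegral le_rfl
  rw [stripTail_zero, coneMeasure_stripDomain, ← Set.Ioc_union_Ioi_eq_Ioi hT,
    lintegral_union measurableSet_Ioi (Set.Ioc_disjoint_Ioi le_rfl),
    ← coneMeasure_stripTail_eq_setLIntegral hT, ← ofReal_integral_eq_lintegral_ofReal
      ((continuous_gapTimeDensity.integrableOn_Icc (a := 0) (b := T)).mono_set
        Set.Ioc_subset_Icc_self) (Filter.Eventually.of_forall gapTimeDensity_nonneg),
    ← intervalIntegral.integral_of_le hT] at h0
  have hfin : coneMeasure (stripTail T) ≠ ∞ := fun h => by simp [h] at h0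
  have h1 := congrArg ENNReal.toReal h0
  rw [ENNReal.toReal_add ENNReal.ofReal_ne_top hfin, ENNReal.toReal_ofReal (by positivity),
    ENNReal.toReal_ofReal (intervalIntegral.integral_nonneg hT fun σ _ => gapTimeDensity_nonneg σ)]
    at h1
  linarith

theorem coneMeasure_stripDomain_ne_zero : coneMeasure stripDomain ≠ 0 := by
  rw [coneMeasure_stripDomain]
  exact (ENNReal.ofReal_pos.2 (by positivity)).ne'

instance : IsProbabilityMeasure invariantMeasure where
  measure_univ := by
    have hmeas : Measurable (rowLattice (k := 2)) :=
      (continuous_coinduced_rng (f := rowLattice (k := 2))).measurable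
    have h := haar_modularDomain_ratio MeasurableSet.univ (fun _ => Set.preimage_univ)
      coneMeasure_stripDomain_ne_zero
    rw [invariantMeasure, Measure.smul_apply, Measure.map_apply hmeas MeasurableSet.univ,
      Set.preimage_univ, Measure.restrict_apply MeasurableSet.univ, smul_eq_mul, h, Set.univ_inter]
    refine ENNReal.inv_mul_cancel coneMeasure_stripDomain_ne_zero ?_
    rw [coneMeasure_stripDomain]
    exact ENNReal.ofReal_ne_top

/-! ### The distribution function and its derivative. -/

/-- The complementary distribution function of the covering radius, for `R ≥ 0`. -/
def coverTail (R : ℝ) : ℝ :=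
  1 - 12 / Real.pi ^ 2 * ∫ σ in (0 : ℝ)..2 * R ^ 2, gapTimeDensity σ

theorem hasDerivAt_coverTail (R : ℝ) :
    HasDerivAt coverTail (-(12 / Real.pi ^ 2 * (gapTimeDensity (2 * R ^ 2) * (4 * R)))) R := by
  have h1 : HasDerivAt (fun T : ℝ => ∫ σ in (0 : ℝ)..T, gapTimeDensity σ)
      (gapTimeDensity (2 * R ^ 2)) (2 * R ^ 2) :=
    continuous_gapTimeDensity.integral_hasStrictDerivAt 0 _ |>.hasDerivAt
  have h2 : HasDerivAt (fun R : ℝ => 2 * R ^ 2) (4 * R) R := by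
    refine ((hasDerivAt_pow 2 R).const_mul 2).congr_deriv ?_
    norm_num
    ring
  exact ((h1.comp R h2).const_mul (12 / Real.pi ^ 2)).const_sub 1

theorem coverTail_eq_one {R : ℝ} (hR : 2 * R ^ 2 ≤ 1) : coverTail R = 1 := by
  have h : ∫ σ in (0 : ℝ)..2 * R ^ 2, gapTimeDensity σ = ∫ σ in (0 : ℝ)..2 * R ^ 2, 0 := by
    refine intervalIntegral.integral_congr fun σ hσ => ?_
    rw [Set.uIcc_of_le (by positivity)] at hσ
    exact if_pos (hσ.2.trans hR)
  rw [coverTail, h]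
  simp

theorem invariantMeasure_real_not_cover {R : ℝ} (hR : 0 < R) :
    invariantMeasure.real {L : UnimodularLattice 2 |
      ¬ R • crossPolytope 2 + (L.toSubmodule : Set (Fin 2 → ℝ)) = Set.univ} = coverTail R := by
  rw [measureReal_def, invariantMeasure_not_cover hR coneMeasure_stripDomain_ne_zero,
    ENNReal.toReal_mul, ENNReal.toReal_inv, coneMeasure_stripTail_toReal (by positivity),
    coneMeasure_stripDomain, ENNReal.toReal_ofReal (by positivity), coverTail]
  have := Real.pi_pos.ne'
  field_simp

theorem coverTail_le_tildeP₂ {R R' : ℝ} (h0 : 0 < R') (h : R < R') : coverTail R' ≤ tildeP₂ R := by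
  rw [← invariantMeasure_real_not_cover h0]
  exact measureReal_mono fun L hL => h.trans_le (le_coveringRadius h0 hL)

/-- If `ρ > R` then `R𝔓` does not cover, and if `R'𝔓` fails to cover for some `R' > R` then `ρ ≥ R'
> R`. Continuity of `coverTail` as `R'` decreases to `R` closes the gap, so no attainment of the
infimum is needed. -/
theorem tildeP₂_eq_coverTail {R : ℝ} (hR : 0 < R) : tildeP₂ R = coverTail R := by
  apply le_antisymm
  · rw [← invariantMeasure_real_not_cover hR]
    refine measureReal_mono fun L hL hcov => ?_
    exact absurd (coveringRadius_le hR hcov) (not_le.2 hL)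
  · have hc : Filter.Tendsto coverTail (nhdsWithin R (Set.Ioi R)) (nhds (coverTail R)) :=
      (hasDerivAt_coverTail R).continuousAt.continuousWithinAt
    refine le_of_tendsto hc ?_
    filter_upwards [self_mem_nhdsWithin] with R' hR'
    exact coverTail_le_tildeP₂ (hR.trans hR') hR'

theorem one_div_sqrt_two_sq : 2 * (1 / √2) ^ 2 = (1 : ℝ) := by
  rw [div_pow, one_pow, Real.sq_sqrt (by norm_num)]
  norm_num

theorem tildeP₂_eq_one {R : ℝ} (hR : R < 1 / √2) : tildeP₂ R = 1 := by
  refine le_antisymm measureReal_le_one ?_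
  have := coverTail_le_tildeP₂ (by positivity) hR
  rwa [coverTail_eq_one one_div_sqrt_two_sq.le] at this

theorem hasDerivAt_tildeP₂_of_lt {R : ℝ} (hR : R < 1 / √2) : HasDerivAt tildeP₂ 0 R := by
  refine (hasDerivAt_const R (1 : ℝ)).congr_of_eventuallyEq ?_
  filter_upwards [Iio_mem_nhds hR] with S hS
  exact tildeP₂_eq_one hS

theorem hasDerivAt_tildeP₂_of_pos {R : ℝ} (hR : 0 < R) :
    HasDerivAt tildeP₂ (-(12 / Real.pi ^ 2 * (gapTimeDensity (2 * R ^ 2) * (4 * R)))) R := by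
  refine (hasDerivAt_coverTail R).congr_of_eventuallyEq ?_
  filter_upwards [Ioi_mem_nhds hR] with S hS
  exact tildeP₂_eq_coverTail hS

theorem gapTimeDensity_two_mul_sq {R : ℝ} (hR0 : 0 < R) (hR : 1 < 2 * R ^ 2) :
    12 / Real.pi ^ 2 * (gapTimeDensity (2 * R ^ 2) * (4 * R)) = 24 / Real.pi ^ 2 *
        ((2 * R ^ 2 - 1) / R * Real.log (2 * R ^ 2 / (2 * R ^ 2 - 1)) +
          (1 - R ^ 2) / R * Real.log (R ^ 2 / |1 - R ^ 2|)) := by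
  have e1 : 1 - (2 * R ^ 2)⁻¹ = (2 * R ^ 2 / (2 * R ^ 2 - 1))⁻¹ := by
    have : 2 * R ^ 2 - 1 ≠ 0 := by linarith
    field_simp
  have e2 : 2 * (2 * R ^ 2)⁻¹ - 1 = (1 - R ^ 2) / R ^ 2 := by
    field_simp
  -- At `R = 1` both sides are `log 0 = 0`, through division by zero on the right, so that value
  -- needs no separate case.
  have e3 : Real.log ((1 - R ^ 2) / R ^ 2) = -Real.log (R ^ 2 / |1 - R ^ 2|) := by
    rw [← Real.log_inv, inv_div, ← Real.log_abs ((1 - R ^ 2) / R ^ 2), abs_div,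
      abs_of_pos (by positivity : 0 < R ^ 2)]
  rw [gapTimeDensity, if_neg (not_le.2 hR), inverseGapDensity, Real.negMulLog, Real.negMulLog, e2,
    e3, e1, Real.log_inv, inv_div]
  have hpi := Real.pi_pos.ne'
  set A := Real.log (2 * R ^ 2 / (2 * R ^ 2 - 1))
  set B := Real.log (R ^ 2 / |1 - R ^ 2|)
  field_simp
  ring

end

theorem mainTheorem4 :
    Differentiable ℝ tildeP₂ ∧
    (∀ R : ℝ, R ≤ 1 / Real.sqrt 2 → tildep₂ R = 0) ∧
    (∀ R : ℝ, 1 / Real.sqrt 2 < R →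
      tildep₂ R = 24 / Real.pi ^ 2 *
        ((2 * R ^ 2 - 1) / R * Real.log (2 * R ^ 2 / (2 * R ^ 2 - 1)) +
          (1 - R ^ 2) / R * Real.log (R ^ 2 / |1 - R ^ 2|))) := by
  have hpos : 0 < 1 / √(2 : ℝ) := by positivity
  refine ⟨fun R => ?_, fun R hR => ?_, fun R hR => ?_⟩
  · rcases lt_or_ge R (1 / √2) with h | h
    · exact (hasDerivAt_tildeP₂_of_lt h).differentiableAt
    · exact (hasDerivAt_tildeP₂_of_pos (hpos.trans_le h)).differentiableAt
  · rw [tildep₂, neg_eq_zero]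
    rcases hR.lt_or_eq with h | h
    · exact (hasDerivAt_tildeP₂_of_lt h).deriv
    -- At the endpoint `2R² = 1` the density of the return time is still `0`, so the derivative
    -- vanishes from both sides.
    · rw [h, (hasDerivAt_tildeP₂_of_pos hpos).deriv, one_div_sqrt_two_sq, gapTimeDensity,
        if_pos le_rfl]
      simp
  · have hR0 := hpos.trans hR
    have h1 : 1 < 2 * R ^ 2 := by
      rw [← one_div_sqrt_two_sq]
      gcongr
    rw [tildep₂, (hasDerivAt_tildeP₂_of_pos hR0).deriv, neg_neg, gapTimeDensity_two_mul_sq hR0 h1]
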